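/- Let $k$ be an algebraically closed field of characteristic $0$ and let $m\ge 1$ be an integer. *Setup.* Let $f=(f_1,\dots,f_{N-1})$ be an isolated complete intersection curve singularity germ, $f_i\in k[[x_1,\dots,x_N]]$, and let $\delta_1,\dots,\delta_d\in k[[x_1,\dots,x_N]]^{N-1}$ represent a $k$-basis of the space of first-order deformations $\mathrm{Def}^1(f)=k[[x]]^{N-1}/\big((f)\,k[[x]]^{N-1}+\langle \partial f/\partial x_1,\dots,\partial f/\partial x_N\rangle\big)$. A one-parameter deformation $X/B$ of $f$ is given by $a\in k^d$: $\mathcal O_B=k[[t]]$ and $\mathcal O_X=k[[x_1,\dots,x_N]][[t]]/(f+t\sum_l a_l\delta_l)$. Let $\mathcal P^m=(\mathcal O_X\,\widehat\otimes_{\mathcal O_B}\,\mathcal O_X)/I_\Delta^m$ be the complete module of principal parts, where $I_\Delta$ is the ideal of the diagonal, viewed as an $\mathcal O_X$-module through the left factor. When $(\mathcal P^m)^\vee=\mathrm{Hom}_{\mathcal O_X}(\mathcal P^m,\mathcal O_X)$ is free with basis $e_1,\dots,e_m$ (as holds for general $a$) and $\bar\tau=(\tau_1,\dots,\tau_n)$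 is a list of elements of $\mathcal P^m$, let $I_{\bar\tau}\subset\mathcal O_X$ be the ideal generated by the maximal minors of the $m\times n$ matrix $(e_i(\tau_l))$; it does not depend on the basis. The automatic degeneracies of order $m$ of $f$ are $$\mathrm{AD}^m_{(1)}(f)=\min \dim_k\mathcal O_X/(t,I_{\bar\tau})\ \ (n=m),$$ $$\mathrm{AD}^m_{(2)}(f)=\min \dim_k\mathcal O_X/I_{\bar\tau}\ \ (n=m-1),\qquad \mathrm{AD}^m_{(1,1)}(f)=\min \dim_k\mathcal O_X/I_{\bar\tau}\ \ (n=m+1),$$ where the minima are taken over all one-parameter deformations $X/B$ of $f$ for which $(\mathcal P^m)^\vee$ is free of rank $m$ and over all lists $\bar\tau$ of $n$ elements of $\mathcal P^m$. For a general one-parameter deformation and any list $\bar\tau$ of $m$ elements attaining $\mathrm{AD}^m_{(1)}(f)$, the number of weight-$1$ inflection points of order $m$ limiting to the singularity is the multiplicity $\dim_K\big((\mathcal O_X/I_{\bar\tau})\otimes_{k[[t]]}K\big)$ of the degeneracy locus on the geometric generic fibre, where $K$ is an algebraic closure of $k((t))$. **Theorem.** For the node, i.e. the germ $f=xy\in k[[x,y]]$,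 and every choice of representatives of a basis of $\mathrm{Def}^1(xy)$: (a) $\mathrm{AD}^m_{(1)}(xy)=m(m-1)$. Moreover, for a general one-parameter deformation of the node there are lists $\bar\tau$ attaining this minimum, and for each of them the number of weight-$1$ inflection points of order $m$ limiting to the node is $m(m-1)$. (b) $\mathrm{AD}^m_{(2)}(xy)=\binom{m+1}{4}$ and $\mathrm{AD}^m_{(1,1)}(xy)=\binom{m+2}{4}$. -/

import Mathlib

open scoped TensorProduct

noncomputable section

namespace AutomaticDegeneracy

/-! ### First-order deformations of a germ -/

section Deformations

variable {k : Type*} [Field k] {N c : ℕ}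

/-- For a germ `f = (f₁, …, f_c)` in `k⟦x₁, …, x_N⟧`, the submodule of `k⟦x⟧ ^ c` generated by all
vectors with entries in the ideal `(f)` and by the partial derivatives `∂f/∂x_j`. -/
def trivialDeformations (f : Fin c → MvPowerSeries (Fin N) k) :
    Submodule (MvPowerSeries (Fin N) k) (Fin c → MvPowerSeries (Fin N) k) :=
  Ideal.span (Set.range f) • ⊤ ⊔
    Submodule.span (MvPowerSeries (Fin N) k)
      (Set.range fun (j : Fin N) (i : Fin c) => MvPowerSeries.pderiv k j (f i))

/-- The space `Def¹(f)` of first-order deformations of the complete intersection germ `f`, i.e. the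
cokernel of `Der(k⟦x⟧) → Hom((f)/(f)², k⟦x⟧/(f))`, which is `Ext¹(Ω¹, k⟦x⟧/(f))`. -/
abbrev Def1 (f : Fin c → MvPowerSeries (Fin N) k) : Type _ :=
  (Fin c → MvPowerSeries (Fin N) k) ⧸ trivialDeformations f

/-- A list `δ₁, …, δ_d` of elements of `k⟦x⟧ ^ c` whose classes form a `k`-basis of `Def¹(f)`.
It presents the versal deformation `f + ∑ α_l δ_l = 0` over `k⟦α₁, …, α_d⟧`. -/
structure Def1Basis (f : Fin c → MvPowerSeries (Fin N) k) where
  /-- the dimension of `Def¹(f)` -/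
  d : ℕ
  /-- representatives of the basis vectors -/
  δ : Fin d → Fin c → MvPowerSeries (Fin N) k
  linearIndependent : LinearIndependent k fun l => (Submodule.Quotient.mk (δ l) : Def1 f)
  span_eq_top : Submodule.span k (Set.range fun l => (Submodule.Quotient.mk (δ l) : Def1 f)) = ⊤

/-- The equations `f_i + t ∑_l a_l δ_{l,i}` in `k⟦x⟧⟦t⟧` of the one-parameter deformation obtained
from the versal deformation by `α_l ↦ a_l t`. -/
def deformationEquation {f : Fin c → MvPowerSeries (Fin N) k} (V : Def1Basis f)
    (a : Fin V.d → k) (i : Fin c) : PowerSeries (MvPowerSeries (Fin N) k) :=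
  PowerSeries.C (f i) + PowerSeries.X * PowerSeries.C (∑ l, a l • V.δ l i)

/-- The coordinate ring `𝒪_X = k⟦x⟧⟦t⟧ / (f + t ∑_l a_l δ_l)` of the total space of the
one-parameter deformation with direction `a`. It is an algebra over `𝒪_B = k⟦t⟧`. -/
abbrev TotalRing {f : Fin c → MvPowerSeries (Fin N) k} (V : Def1Basis f) (a : Fin V.d → k) :
    Type _ :=
  PowerSeries (MvPowerSeries (Fin N) k) ⧸ Ideal.span (Set.range (deformationEquation V a))

end Deformations

/-! ### Principal parts and degeneracy ideals -/

/-- For an `A`-algebra `S` the ring `(S ⊗_A S) / I_Δ ^ m`, where `I_Δ` is the kernel of the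
multiplication map. It is an `S`-module through the left factor. -/
abbrev AlgebraicPrincipalParts (A S : Type*) [CommRing A] [CommRing S] [Algebra A S] (m : ℕ) :
    Type _ :=
  (S ⊗[A] S) ⧸ (KaehlerDifferential.ideal A S) ^ m

/-- The complete module of principal parts `𝒫^m_{S/A} = (S ⊗̂_A S) / I_Δ ^ m`: the completion of
`(S ⊗_A S) / I_Δ ^ m` along the Jacobson radical of `S`, which is the maximal ideal of `S` when `S`
is local. -/
abbrev PrincipalParts (A S : Type*) [CommRing A] [CommRing S] [Algebra A S] (m : ℕ) : Type _ :=
  AdicCompletion (Ideal.jacobson (⊥ : Ideal S)) (AlgebraicPrincipalParts A S m)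

/-- The ideal generated by the maximal minors of a matrix. -/
def maximalMinorsIdeal {S : Type*} [CommRing S] {m n : ℕ} (M : Matrix (Fin m) (Fin n) S) :
    Ideal S :=
  Ideal.span {x | ∃ (p : Fin (min m n) ↪o Fin m) (q : Fin (min m n) ↪o Fin n),
    x = (M.submatrix p q).det}

/-- The ideal of the degeneracy locus of the map `S ^ n → 𝒫 → 𝒫ᵛᵛ` given by a list `τ` of `n`
elements of `𝒫 = 𝒫^m_{S/A}`, computed with a basis `e` of `𝒫ᵛ`: it is generated by the maximal
minors of the matrix `(e_i(τ_l))`. It does not depend on `e`. -/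
def degeneracyIdeal {A S : Type*} [CommRing A] [CommRing S] [Algebra A S] {m n : ℕ}
    (e : Module.Basis (Fin m) S (Module.Dual S (PrincipalParts A S m)))
    (τ : Fin n → PrincipalParts A S m) : Ideal S :=
  maximalMinorsIdeal (Matrix.of fun i l => e i (τ l))

/-! ### Automatic degeneracies -/

section Degeneracies

variable {k : Type*} [Field k] {N c : ℕ} {f : Fin c → MvPowerSeries (Fin N) k}

/-- The `k`-dimension of `𝒪_X / I`, with value `⊤` if it is infinite. -/
def colength (V : Def1Basis f) (a : Fin V.d → k) (I : Ideal (TotalRing V a)) : ℕ∞ :=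
  Cardinal.toENat (Module.rank k (TotalRing V a ⧸ I))

/-- The ideal of the special fibre `X₀` in `𝒪_X`. -/
def specialFibreIdeal (V : Def1Basis f) (a : Fin V.d → k) : Ideal (TotalRing V a) :=
  Ideal.span {algebraMap (PowerSeries k) (TotalRing V a) PowerSeries.X}

/-- The weight-one automatic degeneracy of order `m`: the minimum of `dim_k 𝒪_X / (I_{X₀} + I_τ)`
over all one-parameter deformations (for which `𝒫ᵛ` is free of rank `m`, as it is for a general
one, so that the degeneracy ideal is defined) and all lists `τ` of `m` elements of `𝒫`. -/
def AD1 (V : Def1Basis f) (m : ℕ) : ℕ∞ :=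
  sInf {r : ℕ∞ | ∃ (a : Fin V.d → k)
    (e : Module.Basis (Fin m) (TotalRing V a)
      (Module.Dual (TotalRing V a) (PrincipalParts (PowerSeries k) (TotalRing V a) m)))
    (τ : Fin m → PrincipalParts (PowerSeries k) (TotalRing V a) m),
    r = colength V a (specialFibreIdeal V a ⊔ degeneracyIdeal e τ)}

/-- The minimum of `dim_k 𝒪_X / I_τ` over all one-parameter deformations (for which `𝒫ᵛ` is free of
rank `m`) and all lists `τ` of `n` elements of `𝒫`. -/
def minColength (V : Def1Basis f) (m n : ℕ) : ℕ∞ :=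
  sInf {r : ℕ∞ | ∃ (a : Fin V.d → k)
    (e : Module.Basis (Fin m) (TotalRing V a)
      (Module.Dual (TotalRing V a) (PrincipalParts (PowerSeries k) (TotalRing V a) m)))
    (τ : Fin n → PrincipalParts (PowerSeries k) (TotalRing V a) m),
    r = colength V a (degeneracyIdeal e τ)}

/-- The weight-two type-(a) automatic degeneracy of order `m ≥ 1` (lists of `m - 1` elements). -/
def AD2 (V : Def1Basis f) (m : ℕ) : ℕ∞ := minColength V m (m - 1)

/-- The weight-two type-(b) automatic degeneracy of order `m` (lists of `m + 1` elements). -/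
def AD11 (V : Def1Basis f) (m : ℕ) : ℕ∞ := minColength V m (m + 1)

/-- The multiplicity of the intersection of the subscheme `I` of `X` with the geometric generic
fibre of `X / B`: the dimension of `(𝒪_X / I) ⊗ K` over an algebraic closure `K` of `k((t))`. -/
def genericFibreMultiplicity (V : Def1Basis f) (a : Fin V.d → k) (I : Ideal (TotalRing V a)) :
    ℕ∞ :=
  Cardinal.toENat (Module.rank (AlgebraicClosure (LaurentSeries k))
    (AlgebraicClosure (LaurentSeries k) ⊗[PowerSeries k] (TotalRing V a ⧸ I)))

/-- In a general one-parameter deformation of `f`, the number of weight-one inflection points of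
order `m` limiting to the singularity is `r`: for all directions `a` outside the zero set of some
nonzero polynomial there are lists `τ` of `m` elements of `𝒫` attaining the minimum that defines the
weight-one automatic degeneracy, and for every such list the degeneracy locus meets the geometric
generic fibre with multiplicity `r`. -/
def LimitingWeightOneCount (V : Def1Basis f) (m : ℕ) (r : ℕ∞) : Prop :=
  ∃ p : MvPolynomial (Fin V.d) k, p ≠ 0 ∧ ∀ a : Fin V.d → k, MvPolynomial.eval a p ≠ 0 →
    (∃ (e : Module.Basis (Fin m) (TotalRing V a)
        (Module.Dual (TotalRing V a) (PrincipalParts (PowerSeries k) (TotalRing V a) m)))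
      (τ : Fin m → PrincipalParts (PowerSeries k) (TotalRing V a) m),
      colength V a (specialFibreIdeal V a ⊔ degeneracyIdeal e τ) = AD1 V m) ∧
    ∀ (e : Module.Basis (Fin m) (TotalRing V a)
        (Module.Dual (TotalRing V a) (PrincipalParts (PowerSeries k) (TotalRing V a) m)))
      (τ : Fin m → PrincipalParts (PowerSeries k) (TotalRing V a) m),
      colength V a (specialFibreIdeal V a ⊔ degeneracyIdeal e τ) = AD1 V m →
        genericFibreMultiplicity V a (degeneracyIdeal e τ) = r

end Degeneracies

/-! ### The node -/

/-- The germ `xy` of a node in `k⟦x, y⟧`. -/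
def node (k : Type*) [Field k] : Fin 1 → MvPowerSeries (Fin 2) k :=
  fun _ => MvPowerSeries.X 0 * MvPowerSeries.X 1

theorem exists_eq_X_mul_add_X_mul {k : Type*} [Field k] (h : MvPowerSeries (Fin 2) k)
    (h0 : MvPowerSeries.constantCoeff h = 0) :
    ∃ q r : MvPowerSeries (Fin 2) k, h = MvPowerSeries.X 0 * q + MvPowerSeries.X 1 * r := by
  classical
  let g : MvPowerSeries (Fin 2) k := fun n => if n 0 = 0 then MvPowerSeries.coeff n h else 0
  have hg : ∀ n, MvPowerSeries.coeff n g = if n 0 = 0 then MvPowerSeries.coeff n h else 0 :=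
    fun n => rfl
  have h1 : (MvPowerSeries.X 0 : MvPowerSeries (Fin 2) k) ∣ h - g := by
    rw [MvPowerSeries.X_dvd_iff]
    intro n hn
    rw [map_sub, hg, if_pos hn, sub_self]
  have h2 : (MvPowerSeries.X 1 : MvPowerSeries (Fin 2) k) ∣ g := by
    rw [MvPowerSeries.X_dvd_iff]
    intro n hn
    rw [hg]
    split_ifs with hn0
    · have : n = 0 := by
        ext i
        fin_cases i
        · exact hn0
        · exact hn
      rw [this, MvPowerSeries.coeff_zero_eq_constantCoeff_apply, h0]
    · rfl
  obtain ⟨q, hq⟩ := h1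
  obtain ⟨r, hr⟩ := h2
  exact ⟨q, r, by rw [← hq, ← hr, sub_add_cancel]⟩

theorem mem_trivialDeformations_node {k : Type*} [Field k] (v : Fin 1 → MvPowerSeries (Fin 2) k) :
    v ∈ trivialDeformations (node k) ↔ MvPowerSeries.constantCoeff (v 0) = 0 := by
  have hd0 : ∀ i, MvPowerSeries.pderiv k 0 (node k i) = MvPowerSeries.X 1 := by
    intro i
    simp [node, Derivation.leibniz]
  have hd1 : ∀ i, MvPowerSeries.pderiv k 1 (node k i) = MvPowerSeries.X 0 := by
    intro i
    simp [node, Derivation.leibniz]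
  constructor
  · intro hv
    let K : Submodule (MvPowerSeries (Fin 2) k) (Fin 1 → MvPowerSeries (Fin 2) k) :=
      Submodule.comap (LinearMap.proj 0)
        (RingHom.ker (MvPowerSeries.constantCoeff (σ := Fin 2) (R := k)))
    have hle : trivialDeformations (node k) ≤ K := by
      refine sup_le ?_ ?_
      · rw [Submodule.smul_le]
        intro r hr w _
        have hr' : r ∈ RingHom.ker (MvPowerSeries.constantCoeff (σ := Fin 2) (R := k)) := by
          refine (Ideal.span_le.2 ?_) hr
          rintro _ ⟨i, rfl⟩
          simp [node, RingHom.mem_ker]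
        change MvPowerSeries.constantCoeff (r * w 0) = 0
        rw [map_mul, RingHom.mem_ker.1 hr', zero_mul]
      · rw [Submodule.span_le]
        rintro _ ⟨j, rfl⟩
        change MvPowerSeries.constantCoeff (MvPowerSeries.pderiv k j (node k 0)) = 0
        fin_cases j
        · exact (congrArg _ (hd0 0)).trans (MvPowerSeries.constantCoeff_X 1)
        · exact (congrArg _ (hd1 0)).trans (MvPowerSeries.constantCoeff_X 0)
    exact hle hv
  · intro hv
    obtain ⟨q, r, hqr⟩ := exists_eq_X_mul_add_X_mul (v 0) hv
    have hv' : v = q • (fun i => MvPowerSeries.pderiv k 1 (node k i)) +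
        r • (fun i => MvPowerSeries.pderiv k 0 (node k i)) := by
      funext i
      rw [Subsingleton.elim i 0]
      simp only [Pi.add_apply, Pi.smul_apply, hd0, hd1, smul_eq_mul]
      rw [hqr]
      ring
    rw [hv']
    refine Submodule.mem_sup_right (add_mem ?_ ?_) <;>
      exact Submodule.smul_mem _ _ (Submodule.subset_span ⟨_, rfl⟩)

/-- The class of `1` is a basis of `Def¹(xy)`. -/
def nodeDef1Basis (k : Type*) [Field k] : Def1Basis (node k) where
  d := 1
  δ := fun _ _ => 1
  linearIndependent := by
    rw [linearIndependent_unique_iff, Ne, Submodule.Quotient.mk_eq_zero,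
      mem_trivialDeformations_node]
    simp
  span_eq_top := by
    rw [eq_top_iff]
    rintro w -
    obtain ⟨v, rfl⟩ := Submodule.Quotient.mk_surjective _ w
    have : (Submodule.Quotient.mk v : Def1 (node k)) =
        MvPowerSeries.constantCoeff (v 0) •
          (Submodule.Quotient.mk (fun _ => 1) : Def1 (node k)) := by
      rw [← Submodule.Quotient.mk_smul, Submodule.Quotient.eq, mem_trivialDeformations_node]
      simp
    rw [this]
    exact Submodule.smul_mem _ _ (Submodule.subset_span ⟨0, rfl⟩)

end AutomaticDegeneracy

end

/-!
If the equation of the deformation is `xy + t u` with `u(0) = 0`, then `u` represents `0` in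
`Def¹(xy)`, so the deformation is `xy = 0` and, for `1 < m`, the dual of the principal parts is not
free. Otherwise `𝒪_X` is `k⟦x, y⟧` with `t = xy`, up to units.

The vector field `θ = x ∂/∂x - y ∂/∂y` is defined over `k⟦t⟧` and has eigenfunctions `x ^ n` and
`y ^ n` of weights `n` and `-n`; its iterates `θ ^ 0, …, θ ^ (m - 1)` induce a basis of the dual of
the principal parts. Conversely, `(1 ⊗ s - s ⊗ 1) ^ m = 0` forces the value of any functional at the
jet of `x ^ n` or `y ^ n` to be divisible by `x ^ n` or `y ^ n`. So a minor of size `s` is a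
combination of products of `s` eigenfunctions of distinct weights. With `a` weights `0, …, a - 1`
and `b` weights `-1, …, -b` this gives `x ^ (a(a-1)/2) y ^ (b(b+1)/2)`, `a + b = s`, and every
degeneracy ideal lies in the monomial ideal `J_s` generated by these. Counting the monomials under
this staircase gives colength `(s + 2).choose 4`, and since the determinants of weights that occur
are Vandermonde, hence units in characteristic `0`, the list `x ^ i + y ^ (n - i)`, `i < n`, attains
the bound up to Nakayama's lemma.

For lists of length `m` the degeneracy ideal is generated by one `g`. On the special fibre `xy = 0`
the best case is `g = x ^ (m(m-1)/2) + y ^ (m(m-1)/2)`, of colength `m(m-1)`. When the colength is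
finite, `𝒪_X / (g)` is free over `k⟦t⟧`, so the multiplicity on the generic fibre is the same.
-/

namespace AutomaticDegeneracy

/-! ### Functionals on principal parts -/

section DualComap

variable {S P : Type*} [CommRing S] [AddCommGroup P] [Module S P]

variable (P) in
/-- The submodule of those elements of `P` at which every functional takes its value in the ideal
`I`. For the powers of `I` these are the neighbourhoods of `0` in the weak topology of `P`. -/
def dualComap (I : Ideal S) : Submodule S P := ⨅ D : Module.Dual S P, Submodule.comap D I

theorem mem_dualComap {I : Ideal S} {τ : P} :
    τ ∈ dualComap P I ↔ ∀ D : Module.Dual S P, D τ ∈ I := by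
  simp [dualComap]

theorem smul_top_le_dualComap (I : Ideal S) : I • ⊤ ≤ dualComap P I :=
  le_iInf fun D => by simpa using Submodule.smul_top_le_comap_smul_top I D

theorem dual_ext_of_sup_dualComap_pow_eq_top {I : Ideal S} [IsHausdorff I S] {W : Submodule S P}
    (hW : ∀ n, W ⊔ dualComap P (I ^ n) = ⊤) {D D' : Module.Dual S P}
    (h : ∀ τ ∈ W, D τ = D' τ) : D = D' := by
  refine LinearMap.ext fun τ => ?_
  rw [← sub_eq_zero]
  refine IsHausdorff.haus (I := I) inferInstance _ fun n => ?_
  obtain ⟨p, hp, q, hq, rfl⟩ := Submodule.mem_sup.1 (hW n ▸ Submodule.mem_top : τ ∈ _)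
  rw [SModEq.zero]
  simpa [h p hp] using mem_dualComap.1 hq (D - D')

end DualComap

section Jets

variable {A S : Type*} [CommRing A] [CommRing S] [Algebra A S] {m : ℕ}

variable (A m) in
/-- The `m`-jet of a function `f`: the image of `1 ⊗ f` in the complete module of principal
parts. -/
noncomputable def jet (f : S) : PrincipalParts A S m :=
  AdicCompletion.of _ _ (Ideal.Quotient.mk _ ((1 : S) ⊗ₜ[A] f))

theorem of_mk_tmul (s f : S) :
    (AdicCompletion.of _ _ (Ideal.Quotient.mk _ (s ⊗ₜ[A] f)) : PrincipalParts A S m) =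
      s • jet A m f := by
  rw [jet, ← map_smul]
  congr 1
  change _ = Ideal.Quotient.mk _ (s • ((1 : S) ⊗ₜ[A] f))
  rw [TensorProduct.smul_tmul', smul_eq_mul, mul_one]

theorem jet_zero : jet A m (0 : S) = 0 := by
  simp [jet]

theorem jet_add (f g : S) : jet A m (f + g) = jet A m f + jet A m g := by
  simp [jet, TensorProduct.tmul_add]

theorem jet_algebraMap_mul (a : A) (f : S) :
    jet A m (algebraMap A S a * f) = algebraMap A S a • jet A m f := by
  rw [← of_mk_tmul, jet, ← Algebra.smul_def, ← TensorProduct.smul_tmul, Algebra.smul_def, mul_one]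

theorem of_mem_span_jet (q : AlgebraicPrincipalParts A S m) :
    (AdicCompletion.of _ _ q : PrincipalParts A S m) ∈
      Submodule.span S (Set.range (jet A m : S → PrincipalParts A S m)) := by
  obtain ⟨q, rfl⟩ := Ideal.Quotient.mk_surjective q
  induction q with
  | zero => simp
  | add a b ha hb => simpa only [map_add] using add_mem ha hb
  | tmul a b =>
    rw [of_mk_tmul]
    exact Submodule.smul_mem _ _ (Submodule.subset_span ⟨b, rfl⟩)

theorem span_jet_sup_dualComap_jacobson_pow (hJ : (Ideal.jacobson (⊥ : Ideal S)).FG) (n : ℕ) :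
    Submodule.span S (Set.range (jet A m : S → PrincipalParts A S m)) ⊔
      dualComap _ (Ideal.jacobson (⊥ : Ideal S) ^ n) = ⊤ := by
  refine eq_top_iff.2 fun τ _ => ?_
  obtain ⟨q, hq⟩ := Submodule.Quotient.mk_surjective _ (AdicCompletion.eval _ _ n τ)
  refine Submodule.mem_sup.2 ⟨AdicCompletion.of _ _ q, of_mem_span_jet q,
    τ - AdicCompletion.of _ _ q, smul_top_le_dualComap _ ?_, add_sub_cancel _ _⟩
  rw [AdicCompletion.pow_smul_top_eq_ker_eval hJ, LinearMap.mem_ker, map_sub, ← hq,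
    AdicCompletion.eval_of, Submodule.mkQ_apply, sub_self]

theorem dual_ext_jet [IsHausdorff (Ideal.jacobson (⊥ : Ideal S)) S]
    (hJ : (Ideal.jacobson (⊥ : Ideal S)).FG)
    {D D' : Module.Dual S (PrincipalParts A S m)} (h : ∀ f, D (jet A m f) = D' (jet A m f)) :
    D = D' :=
  dual_ext_of_sup_dualComap_pow_eq_top (span_jet_sup_dualComap_jacobson_pow hJ)
    fun _ hτ => LinearMap.eqOn_span (by rintro _ ⟨f, rfl⟩; exact h f) hτ

theorem exists_dual_apply_of_eq [IsAdicComplete (Ideal.jacobson (⊥ : Ideal S)) S]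
    (D : AlgebraicPrincipalParts A S m →ₗ[S] S) :
    ∃ D' : Module.Dual S (PrincipalParts A S m), ∀ q, D' (AdicCompletion.of _ _ q) = D q := by
  refine ⟨(AdicCompletion.ofLinearEquiv (Ideal.jacobson (⊥ : Ideal S)) S).symm.toLinearMap ∘ₗ
    (AdicCompletion.map (Ideal.jacobson (⊥ : Ideal S)) D).restrictScalars S, fun q => ?_⟩
  simp [AdicCompletion.map_of]

/-! ### Functionals from derivations -/

theorem baseChange_derivation_mul (θ : Derivation A S S) (p q : S ⊗[A] S) :
    θ.toLinearMap.baseChange S (p * q) =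
      p * θ.toLinearMap.baseChange S q + q * θ.toLinearMap.baseChange S p := by
  induction p with
  | zero => simp
  | add a b ha hb => rw [add_mul, map_add, ha, hb, map_add]; ring
  | tmul a b =>
    induction q with
    | zero => simp
    | add c d hc hd => rw [mul_add, map_add, hc, hd, map_add]; ring
    | tmul c d =>
      simp only [Algebra.TensorProduct.tmul_mul_tmul, LinearMap.baseChange_tmul]
      rw [mul_comm c a, ← TensorProduct.tmul_add]
      simp

theorem baseChange_derivation_mem_pow (θ : Derivation A S S) (I : Ideal (S ⊗[A] S)) (n : ℕ)
    {z : S ⊗[A] S} (hz : z ∈ I ^ (n + 1)) : θ.toLinearMap.baseChange S z ∈ I ^ n := by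
  induction n generalizing z with
  | zero => simp
  | succ n ih =>
    rw [pow_succ] at hz
    induction hz using Submodule.mul_induction_on' with
    | mem_mul_mem p hp q hq =>
      rw [baseChange_derivation_mul]
      refine add_mem (Ideal.mul_mem_right _ _ hp) ?_
      rw [pow_succ']
      exact Ideal.mul_mem_mul hq (ih hp)
    | add a _ b _ ha hb => rw [map_add]; exact add_mem ha hb

theorem baseChange_derivation_pow_mem_pow (θ : Derivation A S S) (I : Ideal (S ⊗[A] S)) (i n : ℕ)
    {z : S ⊗[A] S} (hz : z ∈ I ^ (n + i)) : (θ.toLinearMap.baseChange S ^ i) z ∈ I ^ n := by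
  induction i generalizing n with
  | zero => simpa using hz
  | succ i ih =>
    rw [pow_succ', Module.End.mul_apply]
    exact baseChange_derivation_mem_pow θ I n (ih (n + 1) (by rwa [add_right_comm]))

theorem baseChange_derivation_pow_one_tmul (θ : Derivation A S S) (i : ℕ) (f : S) :
    (θ.toLinearMap.baseChange S ^ i) ((1 : S) ⊗ₜ[A] f) = 1 ⊗ₜ θ^[i] f := by
  induction i with
  | zero => simp
  | succ i ih =>
    rw [pow_succ', Module.End.mul_apply, ih, Function.iterate_succ_apply']
    simp

theorem exists_dual_jet_eq_iterate [IsAdicComplete (Ideal.jacobson (⊥ : Ideal S)) S]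
    (θ : Derivation A S S) {j : ℕ} (hj : j < m) :
    ∃ D : Module.Dual S (PrincipalParts A S m), ∀ f, D (jet A m f) = θ^[j] f := by
  let Φ : S ⊗[A] S →ₗ[S] S :=
    (Algebra.TensorProduct.lmul'' A (S := S)).toLinearMap ∘ₗ θ.toLinearMap.baseChange S ^ j
  have hker : (KaehlerDifferential.ideal A S ^ m).restrictScalars S ≤ LinearMap.ker Φ := fun z hz =>
    Ideal.pow_le_self (by omega : m - j ≠ 0) <|
      baseChange_derivation_pow_mem_pow θ _ j (m - j) (by rwa [Nat.sub_add_cancel hj.le])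
  obtain ⟨D, hD⟩ := exists_dual_apply_of_eq (A := A) (m := m)
    ((Submodule.liftQ _ Φ hker) ∘ₗ
      (Submodule.Quotient.restrictScalarsEquiv S (KaehlerDifferential.ideal A S ^ m)).symm)
  have hΦ (f : S) : D (jet A m f) = Φ (1 ⊗ₜ f) := by
    rw [jet, hD]
    rfl
  refine ⟨D, fun f => ?_⟩
  rw [hΦ, LinearMap.comp_apply, baseChange_derivation_pow_one_tmul]
  exact (Algebra.TensorProduct.lmul'_apply_tmul _ _).trans (one_mul _)

/-! ### Values of functionals on powers -/

variable (D : Module.Dual S (PrincipalParts A S m))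

/-- This is the relation `(1 ⊗ s - s ⊗ 1) ^ m * (1 ⊗ f) = 0` in the principal parts. -/
theorem sum_choose_mul_dual_jet_pow_mul_eq_zero (s f : S) :
    ∑ i ∈ Finset.range (m + 1), (-1) ^ (m - i) * (m.choose i : S) * s ^ (m - i) *
      D (jet A m (s ^ i * f)) = 0 := by
  have hmem : ((1 : S) ⊗ₜ[A] s + (-s) ⊗ₜ[A] (1 : S)) ^ m * ((1 : S) ⊗ₜ[A] f) ∈
      KaehlerDifferential.ideal A S ^ m := by
    refine Ideal.mul_mem_right _ _ (Ideal.pow_mem_pow ?_ m)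
    have := KaehlerDifferential.one_smul_sub_smul_one_mem_ideal A s
    rwa [sub_eq_add_neg, ← TensorProduct.neg_tmul] at this
  have hterm (i : ℕ) : ((1 : S) ⊗ₜ[A] s) ^ i * ((-s) ⊗ₜ[A] (1 : S)) ^ (m - i) *
      (m.choose i : S ⊗[A] S) * ((1 : S) ⊗ₜ[A] f) =
      ((-1) ^ (m - i) * (m.choose i : S) * s ^ (m - i)) ⊗ₜ[A] (s ^ i * f) := by
    rw [show (m.choose i : S ⊗[A] S) = (m.choose i : S) ⊗ₜ[A] (1 : S) from
      Algebra.TensorProduct.natCast_def _]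
    simp only [Algebra.TensorProduct.tmul_pow, Algebra.TensorProduct.tmul_mul_tmul, one_pow,
      one_mul, mul_one]
    rw [neg_pow, mul_right_comm]
  have h0 := congrArg (fun q => D (AdicCompletion.of _ _ q)) (Ideal.Quotient.eq_zero_iff_mem.2 hmem)
  simpa only [map_zero, add_pow, Finset.sum_mul, map_sum, hterm, of_mk_tmul, map_smul,
    smul_eq_mul] using h0

theorem pow_dvd_dual_jet_pow_mul (s f : S) (n : ℕ) : s ^ n ∣ D (jet A m (s ^ (n + m) * f)) := by
  induction n using Nat.strong_induction_on generalizing f with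
  | _ n ih =>
  have hrel := sum_choose_mul_dual_jet_pow_mul_eq_zero D s (s ^ n * f)
  rw [Finset.sum_range_succ, Nat.sub_self, Nat.choose_self, pow_zero, pow_zero, Nat.cast_one,
    one_mul, one_mul, one_mul, ← mul_assoc, ← pow_add, add_comm m n, add_comm,
    ← eq_neg_iff_add_eq_zero] at hrel
  rw [hrel, dvd_neg]
  refine Finset.dvd_sum fun i hi => ?_
  have hi : i < m := Finset.mem_range.1 hi
  rcases lt_or_ge (m - i) n with hlt | hge
  · have hexp : s ^ i * (s ^ n * f) = s ^ (n - (m - i) + m) * f := by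
      rw [← mul_assoc, ← pow_add, show i + n = n - (m - i) + m by omega]
    rw [hexp, show s ^ n = s ^ (m - i) * s ^ (n - (m - i)) by rw [← pow_add]; congr 1; omega]
    exact mul_dvd_mul (dvd_mul_left _ _) (ih (n - (m - i)) (by omega) f)
  · exact Dvd.dvd.mul_right (Dvd.dvd.mul_left (pow_dvd_pow s hge) _) _

theorem dual_jet_pow_eq_zero_of_lt {x : S} (h : ∀ n < m, D (jet A m (x ^ n)) = 0) (n : ℕ) :
    D (jet A m (x ^ n)) = 0 := by
  induction n using Nat.strong_induction_on with
  | _ n ih =>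
  rcases lt_or_ge n m with hn | hn
  · exact h n hn
  have hrel := sum_choose_mul_dual_jet_pow_mul_eq_zero D x (x ^ (n - m))
  rw [Finset.sum_range_succ, Finset.sum_eq_zero, zero_add] at hrel
  · simpa [← pow_add, Nat.add_sub_cancel' hn] using hrel
  · intro i hi
    have hi := Finset.mem_range.1 hi
    rw [← pow_add, ih _ (by omega), mul_zero]

section ProductInBase

variable {x y : S} {t : A} (ht : x * y = algebraMap A S t)

include ht

theorem dual_jet_mul_pow_mul (i : ℕ) (f : S) :
    D (jet A m ((x * y) ^ i * f)) = (x * y) ^ i * D (jet A m f) := by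
  rw [ht, ← map_pow, jet_algebraMap_mul, map_smul, smul_eq_mul]

theorem dual_jet_pow_mul_pow_of_le {i n : ℕ} (h : i ≤ n) :
    D (jet A m (y ^ i * x ^ n)) = (x * y) ^ i * D (jet A m (x ^ (n - i))) := by
  rw [← dual_jet_mul_pow_mul D ht, mul_pow, mul_right_comm, ← pow_add, Nat.add_sub_cancel' h,
    mul_comm]

theorem dual_jet_pow_mul_pow_of_ge {i n : ℕ} (h : n ≤ i) :
    D (jet A m (y ^ i * x ^ n)) = (x * y) ^ n * D (jet A m (y ^ (i - n))) := by
  rw [mul_comm, mul_comm x y, dual_jet_pow_mul_pow_of_le D ((mul_comm y x).trans ht) h]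

theorem pow_dvd_dual_jet_pow (hxy : ∀ (i j : ℕ) (s : S), x ^ i ∣ y ^ j * s → x ^ i ∣ s) (n : ℕ) :
    x ^ n ∣ D (jet A m (x ^ n)) := by
  induction n using Nat.strong_induction_on with
  | _ n ih =>
  have hrel := sum_choose_mul_dual_jet_pow_mul_eq_zero D y (x ^ n)
  rw [Finset.sum_range_succ', add_comm, ← eq_neg_iff_add_eq_zero] at hrel
  simp only [Nat.sub_zero, Nat.choose_zero_right, Nat.cast_one, mul_one, pow_zero, one_mul] at hrel
  have hdvd : x ^ n ∣ (-1) ^ m * y ^ m * D (jet A m (x ^ n)) := by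
    rw [hrel, dvd_neg]
    refine Finset.dvd_sum fun i _ => Dvd.dvd.mul_left ?_ _
    rcases le_or_gt (i + 1) n with hi | hi
    · rw [dual_jet_pow_mul_pow_of_le D ht hi, mul_pow, ← Nat.add_sub_cancel' hi, pow_add,
        Nat.add_sub_cancel_left]
      exact mul_dvd_mul (dvd_mul_right _ _) (ih _ (by omega))
    · rw [dual_jet_pow_mul_pow_of_ge D ht hi.le, mul_pow, mul_assoc]
      exact dvd_mul_right _ _
  rw [mul_assoc] at hdvd
  exact hxy _ _ _ ((IsUnit.dvd_mul_left (isUnit_one.neg.pow m)).1 hdvd)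

theorem dual_jet_pow_eq_zero_of_mul_eq [IsDomain S] (hx : x ≠ 0)
    (h : ∀ n, D (jet A m (x ^ n)) = 0) (n : ℕ) : D (jet A m (y ^ n)) = 0 := by
  have ht' := (mul_comm y x).trans ht
  induction n using Nat.strong_induction_on with
  | _ n ih =>
  have hrel := sum_choose_mul_dual_jet_pow_mul_eq_zero D x (y ^ n)
  rw [Finset.sum_range_succ', Finset.sum_eq_zero, zero_add] at hrel
  · simpa [hx] using hrel
  · intro i _
    rcases le_or_gt (i + 1) n with hi | hi
    · rw [dual_jet_pow_mul_pow_of_le D ht' hi, ih _ (by omega), mul_zero, mul_zero]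
    · rw [dual_jet_pow_mul_pow_of_ge D ht' hi.le, h, mul_zero, mul_zero]

end ProductInBase

end Jets

/-! ### Power series -/

section PowerSeries

theorem prime_X {R : Type*} [CommRing R] [IsDomain R] {n : ℕ} (i : Fin (n + 1)) :
    Prime (MvPowerSeries.X i : MvPowerSeries (Fin (n + 1)) R) := by
  have hX : Prime (MvPowerSeries.X 0 : MvPowerSeries (Fin (n + 1)) R) := by
    have := NoZeroDivisors.to_isDomain (MvPowerSeries (Fin n) R)
    rw [← MulEquiv.prime_iff (MvPowerSeries.finSuccEquiv R n), MvPowerSeries.finSuccEquiv_X_zero]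
    exact PowerSeries.X_prime
  rw [← MulEquiv.prime_iff (MvPowerSeries.renameEquiv R (Equiv.swap 0 i))]
  simpa using hX

theorem X_dvd_X_iff {σ R : Type*} [CommSemiring R] [Nontrivial R] {i j : σ} :
    (MvPowerSeries.X i : MvPowerSeries σ R) ∣ MvPowerSeries.X j ↔ i = j := by
  classical
  refine ⟨fun h => ?_, fun h => h ▸ dvd_rfl⟩
  by_contra hij
  have := MvPowerSeries.X_dvd_iff.1 h (Finsupp.single j 1) (by simp [Ne.symm hij])
  simp [MvPowerSeries.coeff_X] at this

variable {k : Type*} [Field k]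

theorem maximalIdeal_mvPowerSeries :
    IsLocalRing.maximalIdeal (MvPowerSeries (Fin 2) k) =
      Ideal.span {MvPowerSeries.X 0, MvPowerSeries.X 1} := by
  ext f
  rw [IsLocalRing.mem_maximalIdeal, mem_nonunits_iff, MvPowerSeries.isUnit_iff_constantCoeff,
    isUnit_iff_ne_zero, not_not, Ideal.mem_span_pair]
  constructor
  · intro h
    obtain ⟨q, r, h⟩ := exists_eq_X_mul_add_X_mul f h
    exact ⟨q, r, by rw [h]; ring⟩
  · rintro ⟨q, r, rfl⟩
    simp

instance isAdicComplete_maximalIdeal_mvPowerSeries :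
    IsAdicComplete (IsLocalRing.maximalIdeal (MvPowerSeries (Fin 2) k))
      (MvPowerSeries (Fin 2) k) := by
  have hrange : Set.range (MvPowerSeries.X : Fin 2 → MvPowerSeries (Fin 2) k) =
      {MvPowerSeries.X 0, MvPowerSeries.X 1} := by
    ext; simp [Fin.exists_fin_two, eq_comm]
  rw [maximalIdeal_mvPowerSeries, ← hrange]
  infer_instance

/-- For a unit `w` this is the vector field `x ∂/∂x - y ∂/∂y` in the coordinates `x = X₀ w`,
`y = X₁`. -/
theorem exists_derivation_X_one_eq_neg {w : MvPowerSeries (Fin 2) k} (hw : IsUnit w) :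
    ∃ θ : Derivation k (MvPowerSeries (Fin 2) k) (MvPowerSeries (Fin 2) k),
      θ (MvPowerSeries.X 1) = -MvPowerSeries.X 1 ∧
        θ (MvPowerSeries.X 0 * w * MvPowerSeries.X 1) = 0 := by
  have hu : IsUnit (w + MvPowerSeries.X 0 * MvPowerSeries.pderiv k 0 w) := by
    rw [MvPowerSeries.isUnit_iff_constantCoeff] at hw ⊢
    simpa using hw
  obtain ⟨v, hv⟩ := hu.exists_left_inv
  have h00 : MvPowerSeries.pderiv k 0 (MvPowerSeries.X 0 : MvPowerSeries (Fin 2) k) = 1 :=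
    MvPowerSeries.pderiv_X_self
  have h11 : MvPowerSeries.pderiv k 1 (MvPowerSeries.X 1 : MvPowerSeries (Fin 2) k) = 1 :=
    MvPowerSeries.pderiv_X_self
  have h01 : MvPowerSeries.pderiv k 0 (MvPowerSeries.X 1 : MvPowerSeries (Fin 2) k) = 0 :=
    MvPowerSeries.pderiv_X_of_ne (by decide)
  have h10 : MvPowerSeries.pderiv k 1 (MvPowerSeries.X 0 : MvPowerSeries (Fin 2) k) = 0 :=
    MvPowerSeries.pderiv_X_of_ne (by decide)
  refine ⟨v • ((MvPowerSeries.X 0 * (w + MvPowerSeries.X 1 * MvPowerSeries.pderiv k 1 w)) •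
      MvPowerSeries.pderiv k 0 -
    (MvPowerSeries.X 1 * (w + MvPowerSeries.X 0 * MvPowerSeries.pderiv k 0 w)) •
      MvPowerSeries.pderiv k 1), ?_, ?_⟩
  · simp only [Derivation.smul_apply, Derivation.sub_apply, h01, h11, smul_eq_mul]
    linear_combination (-MvPowerSeries.X 1) * hv
  · simp only [Derivation.smul_apply, Derivation.sub_apply, Derivation.leibniz, h00, h01, h10, h11,
      smul_eq_mul]
    ring

theorem derivation_algebraMap_powerSeries_eq_zero {S : Type*} [CommRing S] [Algebra k S]
    [Algebra (PowerSeries k) S] [IsScalarTower k (PowerSeries k) S] {I : Ideal S} [IsHausdorff I S]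
    (hI : algebraMap (PowerSeries k) S PowerSeries.X ∈ I) (θ : Derivation k S S)
    (hθ : θ (algebraMap (PowerSeries k) S PowerSeries.X) = 0) (a : PowerSeries k) :
    θ (algebraMap _ S a) = 0 := by
  have hpow (n : ℕ) : ∀ a : PowerSeries k, θ (algebraMap _ S a) ∈ I ^ n := by
    induction n with
    | zero => simp
    | succ n ih =>
      intro a
      rw [PowerSeries.eq_X_mul_shift_add_const a, map_add, map_add, map_mul, Derivation.leibniz, hθ,
        smul_zero, add_zero, PowerSeries.C_eq_algebraMap, ← IsScalarTower.algebraMap_apply,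
        Derivation.map_algebraMap, add_zero, pow_succ', smul_eq_mul]
      exact Ideal.mul_mem_mul hI (ih _)
  refine IsHausdorff.haus (I := I) inferInstance _ fun n => ?_
  rw [SModEq.zero]
  simpa using hpow n a

end PowerSeries

/-! ### Charts of smoothings of the node -/

/-- A presentation of a `k⟦t⟧`-algebra `S` as `k⟦X₀, X₁⟧`, with `t = X₀ w X₁` for a unit `w`. The
total space of a smoothing of the node has such a chart. -/
structure SmoothingChart (k S : Type*) [Field k] [CommRing S] [Algebra k S]
    [Algebra (PowerSeries k) S] where
  /-- the identification with a ring of power series -/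
  φ : MvPowerSeries (Fin 2) k ≃ₐ[k] S
  /-- the unit in the equation of the parameter -/
  w : (MvPowerSeries (Fin 2) k)ˣ
  algebraMap_X : algebraMap (PowerSeries k) S PowerSeries.X =
    φ (MvPowerSeries.X 0 * (w : MvPowerSeries (Fin 2) k) * MvPowerSeries.X 1)

namespace SmoothingChart

variable {k S : Type*} [Field k] [CommRing S] [Algebra k S] [Algebra (PowerSeries k) S]
  (c : SmoothingChart k S)

/-- The first coordinate, normalized so that the parameter is `x y`. -/
noncomputable def x : S := c.φ (MvPowerSeries.X 0 * (c.w : MvPowerSeries (Fin 2) k))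

/-- The second coordinate. -/
noncomputable def y : S := c.φ (MvPowerSeries.X 1)

theorem x_mul_y : c.x * c.y = algebraMap (PowerSeries k) S PowerSeries.X := by
  simp only [c.algebraMap_X, x, y, map_mul]

theorem y_mul_x : c.y * c.x = algebraMap (PowerSeries k) S PowerSeries.X := by
  rw [mul_comm, x_mul_y]

include c in
theorem isDomain : IsDomain S :=
  have := NoZeroDivisors.to_isDomain (MvPowerSeries (Fin 2) k)
  c.φ.symm.toMulEquiv.isDomain (MvPowerSeries (Fin 2) k)

include c in
theorem isLocalRing : IsLocalRing S := c.φ.toRingEquiv.isLocalRing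

include c in
theorem isNoetherianRing : IsNoetherianRing S :=
  isNoetherianRing_of_ringEquiv _ c.φ.toRingEquiv

theorem associated_x : Associated (c.φ (MvPowerSeries.X 0)) c.x :=
  ⟨c.w.map (c.φ : _ →* S), by simp [x]⟩

theorem prime_x : Prime c.x := by
  rw [← c.associated_x.prime_iff, MulEquiv.prime_iff]
  exact prime_X 0

theorem prime_y : Prime c.y := by
  rw [y, MulEquiv.prime_iff]
  exact prime_X 1

theorem not_x_dvd_y : ¬ c.x ∣ c.y := by
  rw [← c.associated_x.dvd_iff_dvd_left, y, map_dvd_iff, X_dvd_X_iff]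
  simp

theorem not_y_dvd_x : ¬ c.y ∣ c.x := by
  rw [← c.associated_x.dvd_iff_dvd_right, y, map_dvd_iff, X_dvd_X_iff]
  simp

theorem x_pow_dvd_of_dvd_y_pow_mul (i j : ℕ) (s : S) (h : c.x ^ i ∣ c.y ^ j * s) : c.x ^ i ∣ s :=
  have := c.isDomain
  c.prime_x.pow_dvd_of_dvd_mul_left i (fun h' => c.not_x_dvd_y (c.prime_x.dvd_of_dvd_pow h')) h

theorem y_pow_dvd_of_dvd_x_pow_mul (i j : ℕ) (s : S) (h : c.y ^ i ∣ c.x ^ j * s) : c.y ^ i ∣ s :=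
  have := c.isDomain
  c.prime_y.pow_dvd_of_dvd_mul_left i (fun h' => c.not_y_dvd_x (c.prime_y.dvd_of_dvd_pow h')) h

theorem jacobson_eq_map : Ideal.jacobson (⊥ : Ideal S) =
    (IsLocalRing.maximalIdeal (MvPowerSeries (Fin 2) k)).map c.φ.toRingEquiv := by
  have := c.isLocalRing
  rw [IsLocalRing.jacobson_eq_maximalIdeal _ bot_ne_top]
  exact (IsLocalRing.map_ringEquiv_maximalIdeal c.φ.toRingEquiv).symm

theorem jacobson_eq : Ideal.jacobson (⊥ : Ideal S) = Ideal.span {c.x, c.y} := by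
  have := c.isDomain
  rw [c.jacobson_eq_map, maximalIdeal_mvPowerSeries, Ideal.map_span, Set.image_pair,
    Ideal.span_insert, Ideal.span_insert c.x]
  congr 1
  exact Ideal.span_singleton_eq_span_singleton.2 c.associated_x

include c in
theorem jacobson_fg : (Ideal.jacobson (⊥ : Ideal S)).FG := by
  rw [c.jacobson_eq]
  exact Submodule.fg_span (Set.toFinite _)

include c in
theorem isAdicComplete : IsAdicComplete (Ideal.jacobson (⊥ : Ideal S)) S := by
  rw [c.jacobson_eq_map, IsAdicComplete.congr_ringEquiv]
  infer_instance

theorem x_mem_jacobson : c.x ∈ Ideal.jacobson (⊥ : Ideal S) := by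
  rw [c.jacobson_eq]; exact Ideal.subset_span (by simp)

theorem y_mem_jacobson : c.y ∈ Ideal.jacobson (⊥ : Ideal S) := by
  rw [c.jacobson_eq]; exact Ideal.subset_span (by simp)

theorem jacobson_pow_add_le (n : ℕ) :
    Ideal.jacobson (⊥ : Ideal S) ^ (n + n) ≤ Ideal.span {c.x ^ n} ⊔ Ideal.span {c.y ^ n} := by
  rw [c.jacobson_eq, Ideal.span_insert]
  refine Ideal.sup_pow_add_le_pow_sup_pow.trans ?_
  rw [Ideal.span_singleton_pow, Ideal.span_singleton_pow]

theorem exists_eq_algebraMap_add (s : S) :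
    ∃ (a : k) (q r : S), s = algebraMap k S a + c.x * q + c.y * r := by
  set a := MvPowerSeries.constantCoeff (c.φ.symm s)
  obtain ⟨q, r, h⟩ := exists_eq_X_mul_add_X_mul (c.φ.symm s - algebraMap k _ a)
    (by rw [MvPowerSeries.algebraMap_apply]; simp [a])
  refine ⟨a, c.φ (↑c.w⁻¹ * q), c.φ r, c.φ.symm.injective ?_⟩
  simp only [x, y, map_add, map_mul, AlgEquiv.symm_apply_apply, AlgEquiv.commutes]
  linear_combination h - MvPowerSeries.X 0 * q * c.w.mul_inv

theorem exists_mem_adjoin_sub_mem_jacobson_pow (s : S) (n : ℕ) :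
    ∃ p ∈ Algebra.adjoin k {c.x, c.y}, s - p ∈ Ideal.jacobson (⊥ : Ideal S) ^ n := by
  induction n generalizing s with
  | zero => exact ⟨0, zero_mem _, by simp⟩
  | succ n ih =>
    obtain ⟨a, q, r, rfl⟩ := c.exists_eq_algebraMap_add s
    obtain ⟨p, hp, hqp⟩ := ih q
    obtain ⟨p', hp', hrp⟩ := ih r
    refine ⟨algebraMap k S a + c.x * p + c.y * p',
      add_mem (add_mem (algebraMap_mem _ a)
        (mul_mem (Algebra.subset_adjoin (by simp)) hp))
        (mul_mem (Algebra.subset_adjoin (by simp)) hp'), ?_⟩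
    rw [show algebraMap k S a + c.x * q + c.y * r - (algebraMap k S a + c.x * p + c.y * p') =
      c.x * (q - p) + c.y * (r - p') by ring, pow_succ']
    exact add_mem (Ideal.mul_mem_mul c.x_mem_jacobson hqp) (Ideal.mul_mem_mul c.y_mem_jacobson hrp)

/-- The vector field `x ∂/∂x - y ∂/∂y`, dual to the logarithmic form `dx / x` on the fibres. -/
theorem exists_derivation [IsScalarTower k (PowerSeries k) S] :
    ∃ θ : Derivation (PowerSeries k) S S, θ c.x = c.x ∧ θ c.y = -c.y := by
  have := c.isDomain
  have hcomplete := c.isAdicComplete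
  obtain ⟨D, hDy, hDt⟩ := exists_derivation_X_one_eq_neg c.w.isUnit
  let θ : Derivation k S S :=
    Derivation.mk' (c.φ.toLinearMap ∘ₗ D.toLinearMap ∘ₗ c.φ.symm.toLinearMap)
      fun s s' => by simp [Derivation.leibniz]
  have hθ (s : S) : θ s = c.φ (D (c.φ.symm s)) := rfl
  have hθy : θ c.y = -c.y := by rw [hθ, y, AlgEquiv.symm_apply_apply, hDy, map_neg]
  have hθt : θ (algebraMap (PowerSeries k) S PowerSeries.X) = 0 := by
    rw [hθ, c.algebraMap_X, AlgEquiv.symm_apply_apply, hDt, map_zero]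
  have hθx : θ c.x = c.x := by
    rw [← c.x_mul_y, Derivation.leibniz, hθy, smul_eq_mul, smul_eq_mul] at hθt
    refine mul_left_cancel₀ c.prime_y.ne_zero ?_
    linear_combination hθt
  have hθ_base := derivation_algebraMap_powerSeries_eq_zero
    (c.x_mul_y ▸ Ideal.mul_mem_right _ _ c.x_mem_jacobson) θ hθt
  refine ⟨Derivation.mk' { toFun := θ, map_add' := map_add θ, map_smul' := fun a s => ?_ }
    fun s s' => θ.leibniz s s', hθx, hθy⟩
  rw [Algebra.smul_def, θ.leibniz, hθ_base, smul_zero, add_zero, RingHom.id_apply,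
    algebraMap_smul]

end SmoothingChart

/-! ### Jets of weight generators and bases of functionals -/

theorem isUnit_det_vandermonde_intCast (k : Type*) {S : Type*} [Field k] [CharZero k] [CommRing S]
    [Algebra k S] {m : ℕ} {ν : Fin m → ℤ} (hν : Function.Injective ν) :
    IsUnit (Matrix.vandermonde fun i => (ν i : S)).det := by
  have hmap : Matrix.vandermonde (fun i => (ν i : S)) =
      (algebraMap k S).mapMatrix (Matrix.vandermonde fun i => (ν i : k)) := by
    ext i j; simp [Matrix.vandermonde_apply]
  rw [hmap, ← RingHom.map_det]
  refine IsUnit.map _ (isUnit_iff_ne_zero.2 ?_)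
  rw [Matrix.det_vandermonde_ne_zero_iff]
  exact Int.cast_injective.comp hν

/-- The matrix `V` is the matrix of `Θ` with respect to the `ι → S`-valued coordinates
`D ↦ ev n D / d n`. -/
theorem exists_basis_coe_eq {S P ι : Type*} [CommRing S] [IsDomain S] [AddCommGroup P]
    [Module S P] [Fintype ι] [DecidableEq ι] {ev : ι → P →ₗ[S] S} {d : ι → S}
    (hd : ∀ n, d n ≠ 0) (hdvd : ∀ D n, d n ∣ ev n D) (hev : ∀ D, (∀ n, ev n D = 0) → D = 0)
    {Θ : ι → P} {V : Matrix ι ι S} (hV : IsUnit V.det) (hΘ : ∀ n j, ev n (Θ j) = V n j * d n) :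
    ∃ e : Module.Basis ι S P, ⇑e = Θ := by
  have hsum (g : ι → S) (n : ι) : ev n (∑ j, g j • Θ j) = V.mulVec g n * d n := by
    simp only [map_sum, map_smul, hΘ, smul_eq_mul, Matrix.mulVec, dotProduct, Finset.sum_mul]
    exact Finset.sum_congr rfl fun j _ => by ring
  have hli : LinearIndependent S Θ := by
    rw [Fintype.linearIndependent_iff]
    intro g hg
    refine congrFun (Matrix.eq_zero_of_mulVec_eq_zero hV.ne_zero (funext fun n => ?_))
    simpa [hg, hd n] using hsum g n
  have hspan : ⊤ ≤ Submodule.span S (Set.range Θ) := by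
    intro D _
    choose q hq using hdvd D
    have hD : D - ∑ j, V⁻¹.mulVec q j • Θ j = 0 := hev _ fun n => by
      rw [map_sub, hsum, Matrix.mulVec_mulVec, Matrix.mul_nonsing_inv _ hV, Matrix.one_mulVec, hq,
        mul_comm, sub_self]
    rw [sub_eq_zero.1 hD]
    exact Submodule.sum_mem _ fun j _ => Submodule.smul_mem _ _ (Submodule.subset_span ⟨j, rfl⟩)
  exact ⟨Module.Basis.mk hli hspan, Module.Basis.coe_mk hli hspan⟩

namespace SmoothingChart

variable {k S : Type*} [Field k] [CommRing S] [Algebra k S] [Algebra (PowerSeries k) S]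
  (c : SmoothingChart k S) {m : ℕ}

/-- The generator over `k⟦t⟧` of the functions of weight `n`, where `x` has weight `1` and `y` has
weight `-1`: it is `x ^ n` for `0 ≤ n` and `y ^ (-n)` for `n ≤ 0`. -/
noncomputable def weightGen (n : ℤ) : S := c.x ^ n.toNat * c.y ^ (-n).toNat

@[simp]
theorem weightGen_zero : c.weightGen 0 = 1 := by simp [weightGen]

@[simp]
theorem weightGen_natCast (n : ℕ) : c.weightGen n = c.x ^ n := by simp [weightGen]

@[simp]
theorem weightGen_neg_natCast (n : ℕ) : c.weightGen (-n) = c.y ^ n := by simp [weightGen]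

theorem x_pow_mul_y_pow (i j : ℕ) :
    c.x ^ i * c.y ^ j = (c.x * c.y) ^ (min i j) * c.weightGen (i - j) := by
  rw [weightGen, mul_pow, mul_mul_mul_comm, ← pow_add, ← pow_add]
  congr 2 <;> omega

theorem derivation_weightGen {θ : Derivation (PowerSeries k) S S} (hx : θ c.x = c.x)
    (hy : θ c.y = -c.y) (n : ℤ) : θ (c.weightGen n) = n * c.weightGen n := by
  obtain ⟨n, rfl | rfl⟩ := n.eq_nat_or_neg <;> rcases n with _ | n
  · simp
  · rw [weightGen_natCast, Derivation.leibniz_pow, hx]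
    simp [pow_succ]
  · simp
  · rw [weightGen_neg_natCast, Derivation.leibniz_pow, hy]
    simp only [Nat.add_sub_cancel, smul_eq_mul, nsmul_eq_mul, Int.cast_neg, Int.cast_natCast]
    ring

theorem iterate_derivation_weightGen {θ : Derivation (PowerSeries k) S S} (hx : θ c.x = c.x)
    (hy : θ c.y = -c.y) (n : ℤ) (j : ℕ) : θ^[j] (c.weightGen n) = n ^ j * c.weightGen n := by
  induction j with
  | zero => simp
  | succ j ih =>
    rw [Function.iterate_succ_apply', ih, Derivation.leibniz, c.derivation_weightGen hx hy,
      Derivation.leibniz_pow, Derivation.map_intCast]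
    simp only [smul_eq_mul, mul_zero, smul_zero, add_zero]
    ring

theorem weightGen_dvd_dual_jet (D : Module.Dual S (PrincipalParts (PowerSeries k) S m)) (n : ℤ) :
    c.weightGen n ∣ D (jet (PowerSeries k) m (c.weightGen n)) := by
  obtain ⟨n, rfl | rfl⟩ := n.eq_nat_or_neg
  · rw [weightGen_natCast]
    exact pow_dvd_dual_jet_pow D c.x_mul_y c.x_pow_dvd_of_dvd_y_pow_mul n
  · rw [weightGen_neg_natCast]
    exact pow_dvd_dual_jet_pow D c.y_mul_x c.y_pow_dvd_of_dvd_x_pow_mul n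

include c in
theorem jet_mem_dualComap_of_mem_jacobson_pow {f : S} {n : ℕ}
    (hf : f ∈ Ideal.jacobson (⊥ : Ideal S) ^ ((n + m) + (n + m))) :
    jet (PowerSeries k) m f ∈ dualComap _ (Ideal.jacobson (⊥ : Ideal S) ^ n) := by
  obtain ⟨_, hu, _, hv, rfl⟩ := Submodule.mem_sup.1 (c.jacobson_pow_add_le _ hf)
  obtain ⟨u, rfl⟩ := Ideal.mem_span_singleton.1 hu
  obtain ⟨v, rfl⟩ := Ideal.mem_span_singleton.1 hv
  refine mem_dualComap.2 fun D => ?_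
  rw [jet_add, map_add]
  exact add_mem
    (Ideal.mem_of_dvd _ (pow_dvd_dual_jet_pow_mul D c.x u n) (Ideal.pow_mem_pow c.x_mem_jacobson n))
    (Ideal.mem_of_dvd _ (pow_dvd_dual_jet_pow_mul D c.y v n) (Ideal.pow_mem_pow c.y_mem_jacobson n))

variable [IsScalarTower k (PowerSeries k) S]

theorem jet_mem_span_of_mem_adjoin {p : S} (hp : p ∈ Algebra.adjoin k {c.x, c.y}) :
    jet (PowerSeries k) m p ∈
      Submodule.span S (Set.range fun l => jet (PowerSeries k) m (c.weightGen l)) := by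
  rw [← Subalgebra.mem_toSubmodule, Algebra.adjoin_eq_span] at hp
  induction hp using Submodule.span_induction with
  | mem p hp =>
    obtain ⟨i, j, rfl⟩ := (Submonoid.mem_closure_pair _ _ _).1 hp
    rw [x_pow_mul_y_pow, x_mul_y, ← map_pow, jet_algebraMap_mul]
    exact Submodule.smul_mem _ _ (Submodule.subset_span ⟨_, rfl⟩)
  | zero => rw [jet_zero]; exact zero_mem _
  | add p q _ _ hp hq => rw [jet_add]; exact add_mem hp hq
  | smul a p _ hp =>
    rw [← algebraMap_smul (PowerSeries k), Algebra.smul_def, jet_algebraMap_mul]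
    exact Submodule.smul_mem _ _ hp

theorem span_jet_weightGen_sup_dualComap (n : ℕ) :
    Submodule.span S (Set.range fun l => jet (PowerSeries k) m (c.weightGen l)) ⊔
      dualComap _ (Ideal.jacobson (⊥ : Ideal S) ^ n) = ⊤ := by
  rw [eq_top_iff, ← span_jet_sup_dualComap_jacobson_pow c.jacobson_fg n]
  refine sup_le (Submodule.span_le.2 ?_) le_sup_right
  rintro _ ⟨f, rfl⟩
  obtain ⟨p, hp, hfp⟩ := c.exists_mem_adjoin_sub_mem_jacobson_pow f ((n + m) + (n + m))
  rw [← add_sub_cancel p f, jet_add]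
  exact Submodule.add_mem_sup (c.jet_mem_span_of_mem_adjoin hp)
    (c.jet_mem_dualComap_of_mem_jacobson_pow hfp)

theorem dual_eq_zero (D : Module.Dual S (PrincipalParts (PowerSeries k) S m))
    (h : ∀ n < m, D (jet (PowerSeries k) m (c.x ^ n)) = 0) : D = 0 := by
  have := c.isDomain
  have := c.isAdicComplete
  have hx := dual_jet_pow_eq_zero_of_lt D h
  have hy := dual_jet_pow_eq_zero_of_mul_eq D c.x_mul_y c.prime_x.ne_zero hx
  refine dual_ext_of_sup_dualComap_pow_eq_top (c.span_jet_weightGen_sup_dualComap (m := m))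
    fun _ hτ => LinearMap.eqOn_span ?_ hτ
  rintro _ ⟨n, rfl⟩
  obtain ⟨n, rfl | rfl⟩ := n.eq_nat_or_neg
  · simp [hx]
  · simp [hy]

theorem exists_approx_mem_span {ι : Type*}
    (e : ι → Module.Dual S (PrincipalParts (PowerSeries k) S m)) :
    ∃ w : ℤ → ι → S, ∀ (τ : PrincipalParts (PowerSeries k) S m) (n : ℕ),
      ∃ v ∈ Submodule.span S (Set.range fun l => c.weightGen l • w l),
        ∀ i, e i τ - v i ∈ Ideal.jacobson (⊥ : Ideal S) ^ n := by
  choose w hw using fun (l : ℤ) (i : ι) => c.weightGen_dvd_dual_jet (e i) l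
  refine ⟨w, fun τ n => ?_⟩
  obtain ⟨p, hp, q, hq, rfl⟩ := Submodule.mem_sup.1
    (c.span_jet_weightGen_sup_dualComap n ▸ Submodule.mem_top : τ ∈ _)
  refine ⟨LinearMap.pi e p, ?_, fun i => by simpa using mem_dualComap.1 hq (e i)⟩
  have hmap := Submodule.mem_map_of_mem (f := LinearMap.pi e) hp
  rwa [Submodule.map_span, ← Set.range_comp,
    show LinearMap.pi e ∘ _ = _ from funext fun l => funext (hw l)] at hmap

theorem exists_basis_dual_jet_weightGen_eq [CharZero k] :
    ∃ e : Module.Basis (Fin m) S (Module.Dual S (PrincipalParts (PowerSeries k) S m)),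
      ∀ j n, e j (jet _ m (c.weightGen n)) = (n : S) ^ (j : ℕ) * c.weightGen n := by
  have := c.isDomain
  have := c.isAdicComplete
  obtain ⟨θ, hθx, hθy⟩ := c.exists_derivation
  choose Θ hΘ using fun j : Fin m => exists_dual_jet_eq_iterate θ j.2
  have hΘ_weightGen (j : Fin m) (n : ℤ) :
      Θ j (jet _ m (c.weightGen n)) = (n : S) ^ (j : ℕ) * c.weightGen n := by
    rw [hΘ, c.iterate_derivation_weightGen hθx hθy]
  have hV := isUnit_det_vandermonde_intCast k (S := S) (ν := fun i : Fin m => ((i : ℕ) : ℤ))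
    (Nat.cast_injective.comp Fin.val_injective)
  obtain ⟨e, rfl⟩ := exists_basis_coe_eq
    (ev := fun n : Fin m => Module.Dual.eval S _ (jet (PowerSeries k) m (c.x ^ (n : ℕ))))
    (d := fun n => c.x ^ (n : ℕ)) (fun n => pow_ne_zero _ c.prime_x.ne_zero)
    (fun D n => pow_dvd_dual_jet_pow D c.x_mul_y c.x_pow_dvd_of_dvd_y_pow_mul n)
    (fun D hD => c.dual_eq_zero D fun n hn => hD ⟨n, hn⟩) hV
    (fun n j => by simpa [Matrix.vandermonde_apply] using hΘ_weightGen j n)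
  exact ⟨e, hΘ_weightGen⟩

end SmoothingChart

/-! ### The trivial deformation of the node -/

theorem isEmpty_basis_dual_of_mul_eq_zero {A S : Type*} [CommRing A] [CommRing S] [Algebra A S]
    [IsAdicComplete (Ideal.jacobson (⊥ : Ideal S)) S] (hJ : (Ideal.jacobson (⊥ : Ideal S)).FG)
    {m : ℕ} (hm : 1 < m) {x y : S} (hxy : x * y = 0) (hy : ∀ (n : ℕ) (s : S), y ^ n * s = 0 → x ∣ s)
    (hx : ∀ s : S, x * s = 0 → y ∣ s) (h1 : (1 : S) ∉ Ideal.span {x, y})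
    (θ : Derivation A S S) (hθx : θ x = x) (hθ : ∀ f, x ∣ θ f) :
    IsEmpty (Module.Basis (Fin m) S (Module.Dual S (PrincipalParts A S m))) := by
  refine ⟨fun e => h1 ?_⟩
  -- Freeness would allow the functional `ε` induced by `θ` to be divided by `x`.
  obtain ⟨ε, hε⟩ := exists_dual_jet_eq_iterate θ hm
  have y_smul_ε : y • ε = 0 := by
    refine dual_ext_jet hJ fun f => ?_
    obtain ⟨d, hd⟩ := hθ f
    rw [LinearMap.smul_apply, hε, Function.iterate_one, hd, LinearMap.zero_apply, smul_eq_mul,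
      ← mul_assoc, mul_comm y, hxy, zero_mul]
  have x_dvd_repr : ∀ i, x ∣ e.repr ε i := by
    intro i
    refine hy 1 _ ?_
    rw [pow_one, ← smul_eq_mul, ← Finsupp.smul_apply, ← map_smul, y_smul_ε, map_zero,
      Finsupp.zero_apply]
  choose r hr using x_dvd_repr
  let η : Module.Dual S (PrincipalParts A S m) := ∑ i, r i • e i
  have ε_eq : ε = x • η := by
    rw [← e.sum_repr ε, Finset.smul_sum]
    exact Finset.sum_congr rfl fun i _ => by rw [hr, mul_smul]
  have y_dvd : y ∣ η (jet A m x) - 1 := by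
    refine hx _ ?_
    have h2 : ε (jet A m x) = x := by rw [hε, Function.iterate_one, hθx]
    rw [ε_eq, LinearMap.smul_apply, smul_eq_mul] at h2
    rw [mul_sub, h2, mul_one, sub_self]
  have x_dvd : x ∣ η (jet A m x) := by
    refine hy m _ ?_
    have hs := sum_choose_mul_dual_jet_pow_mul_eq_zero η y x
    rw [Finset.sum_range_succ', Finset.sum_eq_zero, zero_add] at hs
    · simpa [mul_assoc, (isUnit_one.neg.pow m).mul_right_eq_zero] using hs
    · intro i _
      rw [pow_succ, mul_assoc (y ^ i), mul_comm y x, hxy, mul_zero, jet_zero, map_zero, mul_zero]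
  obtain ⟨p, hp⟩ := y_dvd
  obtain ⟨q, hq⟩ := x_dvd
  exact Ideal.mem_span_pair.2 ⟨q, -p, by linear_combination hp - hq⟩

theorem isPrecomplete_of_surjective {R M N : Type*} [CommRing R] {I : Ideal R} [AddCommGroup M]
    [Module R M] [AddCommGroup N] [Module R N] [IsPrecomplete I M] {f : M →ₗ[R] N}
    (hf : Function.Surjective f) : IsPrecomplete I N := by
  rw [← AdicCompletion.of_surjective_iff]
  intro z
  obtain ⟨z, rfl⟩ := AdicCompletion.map_surjective I hf z
  obtain ⟨z, rfl⟩ := AdicCompletion.of_surjective I M z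
  exact ⟨f z, (AdicCompletion.map_of _ _ _).symm⟩

theorem isAdicComplete_jacobson_quotient {R : Type*} [CommRing R] [IsNoetherianRing R]
    [IsLocalRing R] [IsAdicComplete (IsLocalRing.maximalIdeal R) R] (I : Ideal R) :
    IsAdicComplete (Ideal.jacobson (⊥ : Ideal (R ⧸ I))) (R ⧸ I) := by
  rcases subsingleton_or_nontrivial (R ⧸ I) with _ | _
  · infer_instance
  have : IsLocalRing (R ⧸ I) := .of_surjective' _ Ideal.Quotient.mk_surjective
  have hmax : Ideal.jacobson (⊥ : Ideal (R ⧸ I)) =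
      (IsLocalRing.maximalIdeal R).map (algebraMap R (R ⧸ I)) := by
    rw [IsLocalRing.jacobson_eq_maximalIdeal _ bot_ne_top, Ideal.Quotient.algebraMap_eq,
      IsLocalRing.map_maximalIdeal_of_surjective _ Ideal.Quotient.mk_surjective]
  rw [hmax, IsAdicComplete.map_algebraMap_iff]
  have := isPrecomplete_of_surjective (I := IsLocalRing.maximalIdeal R) I.mkQ_surjective
  exact { }

theorem C_dvd_iff {R : Type*} [CommRing R] {r : R} {F : PowerSeries R} :
    PowerSeries.C r ∣ F ↔ ∀ n, r ∣ PowerSeries.coeff n F := by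
  constructor
  · rintro ⟨G, rfl⟩ n
    rw [PowerSeries.coeff_C_mul]
    exact dvd_mul_right _ _
  · intro h
    choose G hG using h
    refine ⟨PowerSeries.mk G, ?_⟩
    ext n
    rw [PowerSeries.coeff_C_mul, PowerSeries.coeff_mk, hG]

theorem mk_C_dvd_of_mk_C_pow_mul_eq_zero {R : Type*} [CommRing R] {p q : R} (hp : Prime p)
    (hpq : ¬ p ∣ q) {I : Ideal (PowerSeries R)} (hI : I ≤ Ideal.span {PowerSeries.C p}) (n : ℕ)
    (s : PowerSeries R ⧸ I) (hs : Ideal.Quotient.mk I (PowerSeries.C q) ^ n * s = 0) :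
    Ideal.Quotient.mk I (PowerSeries.C p) ∣ s := by
  obtain ⟨F, rfl⟩ := Ideal.Quotient.mk_surjective s
  rw [← map_pow, ← map_mul, Ideal.Quotient.eq_zero_iff_mem] at hs
  have h := Ideal.mem_span_singleton.1 (hI hs)
  rw [← map_pow, C_dvd_iff] at h
  refine map_dvd _ (C_dvd_iff.2 fun j => ?_)
  have hj := h j
  rw [PowerSeries.coeff_C_mul] at hj
  exact (hp.dvd_or_dvd hj).resolve_left fun hq => hpq (hp.dvd_of_dvd_pow hq)

theorem maximalIdeal_powerSeries {R : Type*} [CommRing R] [IsLocalRing R] :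
    IsLocalRing.maximalIdeal (PowerSeries R) =
      Ideal.span {PowerSeries.X} ⊔ (IsLocalRing.maximalIdeal R).map PowerSeries.C := by
  refine le_antisymm (fun F hF => ?_) (sup_le ?_ ?_)
  · rw [IsLocalRing.mem_maximalIdeal, mem_nonunits_iff, PowerSeries.isUnit_iff_constantCoeff] at hF
    rw [PowerSeries.eq_X_mul_shift_add_const F]
    exact Submodule.add_mem_sup (Ideal.mem_span_singleton.2 (dvd_mul_right _ _))
      (Ideal.mem_map_of_mem _ hF)
  · rw [Ideal.span_singleton_le_iff_mem, IsLocalRing.mem_maximalIdeal, mem_nonunits_iff,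
      PowerSeries.isUnit_iff_constantCoeff]
    simp
  · refine Ideal.map_le_iff_le_comap.2 fun r hr => ?_
    rw [Ideal.mem_comap, IsLocalRing.mem_maximalIdeal, mem_nonunits_iff,
      PowerSeries.isUnit_iff_constantCoeff]
    simpa using hr

instance isAdicComplete_maximalIdeal_powerSeries {k : Type*} [Field k] :
    IsAdicComplete (IsLocalRing.maximalIdeal (PowerSeries (MvPowerSeries (Fin 2) k)))
      (PowerSeries (MvPowerSeries (Fin 2) k)) := by
  have hmax : IsLocalRing.maximalIdeal (PowerSeries (MvPowerSeries (Fin 2) k)) =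
      (Ideal.span (Set.range MvPowerSeries.X)).map
        (MvPowerSeries.optionEquivLeft (Fin 2) k).toRingEquiv := by
    rw [maximalIdeal_powerSeries, maximalIdeal_mvPowerSeries, Ideal.map_span, Ideal.map_span,
      ← Ideal.span_union]
    congr 1
    ext F
    simp [Option.exists, Fin.exists_fin_two, MvPowerSeries.optionEquivLeft_X_none,
      MvPowerSeries.optionEquivLeft_X_some, eq_comm]
  rw [hmax, IsAdicComplete.congr_ringEquiv]
  infer_instance

/-- The derivation of `R⟦t⟧` over `k⟦t⟧` which applies a derivation of `R` over `k` to every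
coefficient. -/
noncomputable def coefficientwiseDerivation {k R : Type*} [CommRing k] [CommRing R] [Algebra k R]
    (D : Derivation k R R) : Derivation (PowerSeries k) (PowerSeries R) (PowerSeries R) :=
  Derivation.mk'
    { toFun F := PowerSeries.mk fun n => D (PowerSeries.coeff n F)
      map_add' F G := by ext1 n; simp
      map_smul' a F := by
        ext1 n
        simp [Algebra.smul_def, PowerSeries.coeff_mul, PowerSeries.algebraMap_apply''] }
    fun F G => by
      ext1 n
      rw [smul_eq_mul, smul_eq_mul, mul_comm G]
      simp only [LinearMap.coe_mk, AddHom.coe_mk, PowerSeries.coeff_mk, PowerSeries.coeff_mul,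
        map_add, map_sum, Derivation.leibniz, smul_eq_mul, Finset.sum_add_distrib]
      congr 1
      exact Finset.sum_congr rfl fun _ _ => mul_comm _ _

section CoefficientwiseDerivation

variable {k R : Type*} [CommRing k] [CommRing R] [Algebra k R] (D : Derivation k R R)

@[simp]
theorem coeff_coefficientwiseDerivation (n : ℕ) (F : PowerSeries R) :
    PowerSeries.coeff n (coefficientwiseDerivation D F) = D (PowerSeries.coeff n F) :=
  PowerSeries.coeff_mk n fun n => D (PowerSeries.coeff n F)

@[simp]
theorem coefficientwiseDerivation_C (r : R) :
    coefficientwiseDerivation D (PowerSeries.C r) = PowerSeries.C (D r) := by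
  ext1 n
  rw [coeff_coefficientwiseDerivation, PowerSeries.coeff_C, PowerSeries.coeff_C]
  split_ifs <;> simp

end CoefficientwiseDerivation

theorem one_notMem_span_C_X {σ k : Type*} [CommRing k] [Nontrivial k]
    {I : Ideal (PowerSeries (MvPowerSeries σ k))} (i j : σ)
    (hI : I ≤ RingHom.ker (MvPowerSeries.constantCoeff.comp PowerSeries.constantCoeff)) :
    (1 : PowerSeries (MvPowerSeries σ k) ⧸ I) ∉ Ideal.span
      {Ideal.Quotient.mk I (PowerSeries.C (MvPowerSeries.X i)),
        Ideal.Quotient.mk I (PowerSeries.C (MvPowerSeries.X j))} := by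
  intro h
  let ev := Ideal.Quotient.lift I _ fun F hF => RingHom.mem_ker.1 (hI hF)
  have hle : Ideal.span {Ideal.Quotient.mk I (PowerSeries.C (MvPowerSeries.X i)),
      Ideal.Quotient.mk I (PowerSeries.C (MvPowerSeries.X j))} ≤ RingHom.ker ev := by
    rw [Ideal.span_le, Set.pair_subset_iff]
    constructor <;> simp [ev, RingHom.mem_ker]
  simpa [RingHom.mem_ker] using hle h

theorem derivation_mem_span_singleton {A S : Type*} [CommRing A] [CommRing S] [Algebra A S]
    (D : Derivation A S S) {g : S} (hg : g ∣ D g) {f : S} (hf : f ∈ Ideal.span {g}) :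
    D f ∈ Ideal.span {g} := by
  rw [Ideal.mem_span_singleton] at hf ⊢
  obtain ⟨q, rfl⟩ := hf
  rw [Derivation.leibniz, smul_eq_mul, smul_eq_mul]
  exact dvd_add (dvd_mul_right _ _) (hg.mul_left _)

theorem exists_derivation_quotient {A S : Type*} [CommRing A] [CommRing S] [Algebra A S]
    (D : Derivation A S S) {I : Ideal S} (hD : ∀ f ∈ I, D f ∈ I) :
    ∃ θ : Derivation A (S ⧸ I) (S ⧸ I),
      ∀ f, θ (Ideal.Quotient.mk I f) = Ideal.Quotient.mk I (D f) := by
  have hmk := Ideal.Quotient.mkₐ_surjective A I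
  have hker : ∀ f, Ideal.Quotient.mkₐ A I f = 0 → Ideal.Quotient.mkₐ A I (D f) = 0 := fun f hf =>
    Ideal.Quotient.eq_zero_iff_mem.2 (hD f (Ideal.Quotient.eq_zero_iff_mem.1 hf))
  exact ⟨Derivation.liftOfSurjective hmk hker, Derivation.liftOfSurjective_apply hmk hker⟩

theorem isEmpty_basis_dual_trivial_deformation {k : Type*} [Field k] {m : ℕ} (hm : 1 < m)
    {I : Ideal (PowerSeries (MvPowerSeries (Fin 2) k))}
    (hI : I = Ideal.span {PowerSeries.C (MvPowerSeries.X 0 * MvPowerSeries.X 1)}) :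
    IsEmpty (Module.Basis (Fin m) (PowerSeries (MvPowerSeries (Fin 2) k) ⧸ I)
      (Module.Dual (PowerSeries (MvPowerSeries (Fin 2) k) ⧸ I)
        (PrincipalParts (PowerSeries k) (PowerSeries (MvPowerSeries (Fin 2) k) ⧸ I) m))) := by
  have := isAdicComplete_jacobson_quotient I
  -- The Euler vector field `x ∂/∂x` preserves the ideal `(xy)`.
  let E := coefficientwiseDerivation
    ((MvPowerSeries.X 0 : MvPowerSeries (Fin 2) k) • MvPowerSeries.pderiv k (0 : Fin 2))
  have E_mem : ∀ F ∈ I, E F ∈ I := by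
    rw [hI]
    exact fun F => derivation_mem_span_singleton E (by simp [E, Derivation.leibniz, mul_comm])
  obtain ⟨θ, θ_mk⟩ := exists_derivation_quotient E E_mem
  refine isEmpty_basis_dual_of_mul_eq_zero (IsNoetherian.noetherian _) hm
    (x := Ideal.Quotient.mk I (PowerSeries.C (MvPowerSeries.X 0)))
    (y := Ideal.Quotient.mk I (PowerSeries.C (MvPowerSeries.X 1)))
    ?_ ?_ ?_ (one_notMem_span_C_X 0 1 ?_) θ ?_ ?_
  · rw [← map_mul, ← map_mul, Ideal.Quotient.eq_zero_iff_mem, hI]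
    exact Ideal.mem_span_singleton_self _
  · refine mk_C_dvd_of_mk_C_pow_mul_eq_zero (prime_X 0) (by simp [X_dvd_X_iff]) ?_
    rw [hI, map_mul]
    exact Ideal.span_singleton_le_span_singleton.2 (dvd_mul_right _ _)
  · intro s hs
    rw [← pow_one (Ideal.Quotient.mk I _)] at hs
    have hX : Prime (MvPowerSeries.X 1 : MvPowerSeries (Fin 2) k) := prime_X 1
    refine mk_C_dvd_of_mk_C_pow_mul_eq_zero hX (by simp [X_dvd_X_iff]) ?_ 1 s hs
    rw [hI, map_mul]
    exact Ideal.span_singleton_le_span_singleton.2 (dvd_mul_left _ _)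
  · rw [hI, Ideal.span_singleton_le_iff_mem, RingHom.mem_ker]
    simp
  · rw [θ_mk]
    simp [E]
  · intro s
    obtain ⟨F, rfl⟩ := Ideal.Quotient.mk_surjective s
    rw [θ_mk]
    refine map_dvd _ (C_dvd_iff.2 fun n => ?_)
    simp [E]

/-! ### Total rings of deformations of the node -/

theorem bijective_mk_comp_C_of_isUnit_coeff_one {R : Type*} [CommRing R] [IsLocalRing R]
    [IsAdicComplete (IsLocalRing.maximalIdeal R) R] {g : PowerSeries R}
    (h0 : PowerSeries.coeff 0 g ∈ IsLocalRing.maximalIdeal R)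
    (h1 : IsUnit (PowerSeries.coeff 1 g)) :
    Function.Bijective ((Ideal.Quotient.mk (Ideal.span {g})).comp PowerSeries.C) := by
  have hord : (g.map (IsLocalRing.residue R)).order = ((1 : ℕ) : ℕ∞) := by
    rw [PowerSeries.order_eq_nat]
    refine ⟨by simpa using h1, fun i hi => ?_⟩
    obtain rfl : i = 0 := by omega
    rwa [PowerSeries.coeff_map, IsLocalRing.residue_eq_zero_iff]
  have hne : g.map (IsLocalRing.residue R) ≠ 0 := by
    rintro h
    simp [h] at hord
  have hdeg : ((g.map (IsLocalRing.residue R)).order.toNat : WithBot ℕ) = 1 := by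
    rw [hord]
    rfl
  constructor
  · rw [injective_iff_map_eq_zero]
    intro f hf
    rw [RingHom.comp_apply, Ideal.Quotient.eq_zero_iff_mem, Ideal.mem_span_singleton] at hf
    obtain ⟨q, hq⟩ := hf
    have := (PowerSeries.IsWeierstrassDivisor.of_map_ne_zero hne).eq_zero_of_mul_eq (q := q)
      (r := Polynomial.C f) (Polynomial.degree_C_le.trans_lt (hdeg ▸ by norm_num))
      (by rw [← hq, Polynomial.coe_C])
    simpa using this.2
  · intro s
    obtain ⟨F, rfl⟩ := Ideal.Quotient.mk_surjective s
    obtain ⟨q, r, hqr⟩ := PowerSeries.exists_isWeierstrassDivision F hne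
    obtain ⟨f, rfl⟩ : ∃ f, r = Polynomial.C f := ⟨_, Polynomial.eq_C_of_degree_le_zero
      (Nat.WithBot.lt_one_iff_le_zero.1 (hqr.degree_lt.trans_eq hdeg))⟩
    refine ⟨f, ?_⟩
    rw [RingHom.comp_apply, Ideal.Quotient.eq, Ideal.mem_span_singleton, hqr.eq_mul_add,
      Polynomial.coe_C]
    exact ⟨-q, by ring⟩

section NodeDeformations

variable {k : Type*} [Field k]

instance isScalarTower_powerSeries :
    IsScalarTower k (PowerSeries k) (PowerSeries (MvPowerSeries (Fin 2) k)) :=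
  IsScalarTower.of_algebraMap_eq fun a => by
    rw [PowerSeries.algebraMap_apply'', PowerSeries.algebraMap_apply, PowerSeries.algebraMap_apply,
      PowerSeries.map_C, Algebra.algebraMap_self, RingHom.id_apply]

variable (V : Def1Basis (node k)) (a : Fin V.d → k)

theorem range_deformationEquation_node :
    Set.range (deformationEquation V a) =
      {PowerSeries.C (MvPowerSeries.X 0 * MvPowerSeries.X 1) +
        PowerSeries.X * PowerSeries.C (∑ l, a l • V.δ l 0)} := by
  rw [Set.range_unique]
  rfl

theorem exists_constantCoeff_ne_zero : ∃ l, MvPowerSeries.constantCoeff (V.δ l 0) ≠ 0 := by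
  by_contra! h
  have hδ : ∀ l, (Submodule.Quotient.mk (V.δ l) : Def1 (node k)) = 0 := by
    intro l
    rw [Submodule.Quotient.mk_eq_zero, mem_trivialDeformations_node, h]
  have htop : (Submodule.Quotient.mk (fun _ => 1) : Def1 (node k)) ∈
      Submodule.span k (Set.range fun l => (Submodule.Quotient.mk (V.δ l) : Def1 (node k))) := by
    rw [V.span_eq_top]
    trivial
  rw [Submodule.span_eq_bot.2 (by rintro _ ⟨l, rfl⟩; exact hδ l), Submodule.mem_bot,
    Submodule.Quotient.mk_eq_zero, mem_trivialDeformations_node] at htop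
  simp at htop

variable {V a}

theorem eq_zero_of_constantCoeff_eq_zero
    (h : MvPowerSeries.constantCoeff (∑ l, a l • V.δ l 0) = 0) : a = 0 := by
  have h1 : (trivialDeformations (node k)).mkQ.restrictScalars k (∑ l, a l • V.δ l) = 0 := by
    refine (Submodule.Quotient.mk_eq_zero _).2 ((mem_trivialDeformations_node _).2 ?_)
    rwa [Finset.sum_apply]
  rw [map_sum] at h1
  exact funext (Fintype.linearIndependent_iff.1 V.linearIndependent a h1)

theorem isEmpty_basis_dual_of_constantCoeff_eq_zero {m : ℕ} (hm : 1 < m)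
    (h : MvPowerSeries.constantCoeff (∑ l, a l • V.δ l 0) = 0) :
    IsEmpty (Module.Basis (Fin m) (TotalRing V a)
      (Module.Dual (TotalRing V a) (PrincipalParts (PowerSeries k) (TotalRing V a) m))) := by
  obtain rfl := eq_zero_of_constantCoeff_eq_zero h
  refine isEmpty_basis_dual_trivial_deformation hm ?_
  rw [range_deformationEquation_node]
  simp

theorem nonempty_smoothingChart (h : MvPowerSeries.constantCoeff (∑ l, a l • V.δ l 0) ≠ 0) :
    Nonempty (SmoothingChart k (TotalRing V a)) := by
  set u := ∑ l, a l • V.δ l 0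
  obtain ⟨v, hv⟩ : IsUnit u := MvPowerSeries.isUnit_iff_constantCoeff.2 (isUnit_iff_ne_zero.2 h)
  set g := PowerSeries.C (MvPowerSeries.X 0 * MvPowerSeries.X 1 : MvPowerSeries (Fin 2) k) +
    PowerSeries.X * PowerSeries.C u with hg
  have hspan : Ideal.span (Set.range (deformationEquation V a)) = Ideal.span {g} := by
    rw [range_deformationEquation_node]
  have hbij : Function.Bijective
      (IsScalarTower.toAlgHom k (MvPowerSeries (Fin 2) k) (TotalRing V a)) := by
    have hbij := bijective_mk_comp_C_of_isUnit_coeff_one (g := g) ?_ ?_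
    · rw [← hspan] at hbij
      exact hbij
    · rw [IsLocalRing.mem_maximalIdeal, mem_nonunits_iff, MvPowerSeries.isUnit_iff_constantCoeff]
      simp [g]
    · simp [g, ← hv]
  -- Solving `xy + t u = 0` for `t`.
  refine ⟨⟨AlgEquiv.ofBijective _ hbij, -v⁻¹, ?_⟩⟩
  change Ideal.Quotient.mk _ _ = Ideal.Quotient.mk _ (PowerSeries.C _)
  rw [Ideal.Quotient.eq, hspan, Ideal.mem_span_singleton, PowerSeries.algebraMap_apply'',
    PowerSeries.map_X]
  have h1 : PowerSeries.C u * PowerSeries.C (↑v⁻¹ : MvPowerSeries (Fin 2) k) = 1 := by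
    rw [← map_mul, ← hv, v.mul_inv, map_one]
  refine ⟨PowerSeries.C ↑v⁻¹, ?_⟩
  rw [hg, Units.val_neg]
  simp only [map_mul, map_neg]
  linear_combination (- PowerSeries.X) * h1

end NodeDeformations

/-! ### Corner ideals -/

theorem choose_two_card_le_sum (A : Finset ℕ) : A.card.choose 2 ≤ ∑ i ∈ A, i := by
  induction A using Finset.induction_on_max with
  | empty => simp
  | insert a s hs ih =>
    have ha : a ∉ s := fun h => lt_irrefl _ (hs a h)
    have hcard : s.card ≤ a := by
      simpa using Finset.card_le_card fun i hi => Finset.mem_range.2 (hs i hi)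
    rw [Finset.card_insert_of_notMem ha, Finset.sum_insert ha, Nat.choose_succ_succ' s.card 1,
      Nat.choose_one_right]
    exact add_le_add hcard ih

theorem eq_range_of_sum_le_choose_two_card (A : Finset ℕ) (h : ∑ i ∈ A, i ≤ A.card.choose 2) :
    A = Finset.range A.card := by
  induction A using Finset.induction_on_max with
  | empty => simp
  | insert a s hs ih =>
    have ha : a ∉ s := fun h => lt_irrefl _ (hs a h)
    have hcard : s.card ≤ a := by
      simpa using Finset.card_le_card fun i hi => Finset.mem_range.2 (hs i hi)
    rw [Finset.card_insert_of_notMem ha, Finset.sum_insert ha, Nat.choose_succ_succ' s.card 1,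
      Nat.choose_one_right, one_add_one_eq_two] at h
    have hle := choose_two_card_le_sum s
    obtain rfl : a = s.card := by omega
    rw [Finset.card_insert_of_notMem ha, Finset.range_add_one, ← ih (by omega)]

theorem choose_two_card_succ_le_sum (A : Finset ℕ) (hA : 0 ∉ A) :
    (A.card + 1).choose 2 ≤ ∑ i ∈ A, i := by
  simpa [hA] using choose_two_card_le_sum (insert 0 A)

theorem insert_zero_eq_range_of_sum_le_choose_two_card_succ (A : Finset ℕ) (hA : 0 ∉ A)
    (h : ∑ i ∈ A, i ≤ (A.card + 1).choose 2) : insert 0 A = Finset.range (A.card + 1) := by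
  have := eq_range_of_sum_le_choose_two_card (insert 0 A) (by simpa [hA] using h)
  rwa [Finset.card_insert_of_notMem hA] at this

theorem choose_two_card_pos_succ_le_sum_toNat {ι : Type*} [Fintype ι] {ν : ι → ℤ}
    (hν : Function.Injective ν) :
    ((Finset.univ.filter fun l => 0 < ν l).card + 1).choose 2 ≤ ∑ l, (ν l).toNat := by
  have hinj : Set.InjOn (fun l => (ν l).toNat) (Finset.univ.filter fun l => 0 < ν l) := by
    intro i hi j hj hij
    simp only [Finset.coe_filter, Finset.mem_univ, true_and, Set.mem_ofPred_eq] at hi hj hij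
    exact hν (by omega)
  have h := choose_two_card_succ_le_sum
    ((Finset.univ.filter fun l => 0 < ν l).image fun l => (ν l).toNat) (by simp)
  rw [Finset.card_image_of_injOn hinj, Finset.sum_image hinj] at h
  exact h.trans (Finset.sum_le_sum_of_subset (Finset.filter_subset _ _))

theorem card_le_card_pos_add_card_neg_add_one {ι : Type*} [Fintype ι] {ν : ι → ℤ}
    (hν : Function.Injective ν) :
    Fintype.card ι ≤ (Finset.univ.filter fun l => 0 < ν l).card +
      (Finset.univ.filter fun l => 0 < -ν l).card + 1 := by
  classical
  have hzero : (Finset.univ.filter fun l => ν l = 0).card ≤ 1 :=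
    Finset.card_le_one.2 fun i hi j hj =>
      hν ((Finset.mem_filter.1 hi).2.trans (Finset.mem_filter.1 hj).2.symm)
  have hcover : (Finset.univ : Finset ι) ⊆ (Finset.univ.filter fun l => 0 < ν l) ∪
      (Finset.univ.filter fun l => 0 < -ν l) ∪ (Finset.univ.filter fun l => ν l = 0) := by
    intro l _
    simp only [Finset.mem_union, Finset.mem_filter, Finset.mem_univ, true_and]
    omega
  rw [← Finset.card_univ]
  grw [Finset.card_le_card hcover, Finset.card_union_le, Finset.card_union_le, hzero]

section MonomialIdeal

variable {S : Type*} [CommRing S] {x y : S} {D : Set (ℕ × ℕ)}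

variable (x y D) in
/-- The ideal generated by the monomials in `x` and `y` with exponents in `D`. -/
def monomialIdeal : Ideal S :=
  Ideal.span ((fun d : ℕ × ℕ => x ^ d.1 * y ^ d.2) '' D)

theorem pow_mul_pow_mem_monomialIdeal {d : ℕ × ℕ} (h : d ∈ D) :
    x ^ d.1 * y ^ d.2 ∈ monomialIdeal x y D :=
  Ideal.subset_span ⟨d, h, rfl⟩

theorem monomialIdeal_le {I : Ideal S} (h : ∀ d ∈ D, x ^ d.1 * y ^ d.2 ∈ I) :
    monomialIdeal x y D ≤ I := by
  rw [monomialIdeal, Ideal.span_le]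
  rintro _ ⟨d, hd, rfl⟩
  exact h d hd

/-- The exponents of the generators of `cornerIdeal`. For `1 ≤ s` the exponent with `a = 0` is
redundant; it makes `0` a corner for `s = 0`. -/
def corners (s : ℕ) : Set (ℕ × ℕ) :=
  {d | ∃ a b, a + b = s ∧ d = (a.choose 2, (b + 1).choose 2)}

theorem finite_corners (s : ℕ) : (corners s).Finite := by
  refine ((Finset.HasAntidiagonal.antidiagonal s).finite_toSet.image
    fun p => (p.1.choose 2, (p.2 + 1).choose 2)).subset ?_
  rintro _ ⟨a, b, h, rfl⟩
  exact ⟨(a, b), by simpa using h, rfl⟩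

variable (x y) in
/-- The ideal generated by the monomials `x ^ (a(a-1)/2) y ^ (b(b+1)/2)` with `a + b = s`. It is
the smallest ideal containing all degeneracy ideals of the node generated by minors of size `s`. -/
def cornerIdeal (s : ℕ) : Ideal S := monomialIdeal x y (corners s)

theorem pow_mul_pow_mem_cornerIdeal {a b s i j : ℕ} (h : a + b = s) (hi : a.choose 2 ≤ i)
    (hj : (b + 1).choose 2 ≤ j) : x ^ i * y ^ j ∈ cornerIdeal x y s :=
  Ideal.mem_of_dvd _ (mul_dvd_mul (pow_dvd_pow x hi) (pow_dvd_pow y hj))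
    (pow_mul_pow_mem_monomialIdeal (D := corners s) ⟨a, b, h, rfl⟩)

theorem prod_mem_cornerIdeal {s : ℕ} {ν : Fin s → ℤ} (hν : Function.Injective ν) :
    ∏ l, (x ^ (ν l).toNat * y ^ (-ν l).toNat) ∈ cornerIdeal x y s := by
  have hp := choose_two_card_pos_succ_le_sum_toNat hν
  have hq := choose_two_card_pos_succ_le_sum_toNat (neg_injective.comp hν)
  have hpq := card_le_card_pos_add_card_neg_add_one hν
  simp only [Function.comp_apply, Fintype.card_fin] at hq hpq
  set p := (Finset.univ.filter fun l => 0 < ν l).card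
  rw [Finset.prod_mul_distrib, Finset.prod_pow_eq_pow_sum, Finset.prod_pow_eq_pow_sum]
  exact pow_mul_pow_mem_cornerIdeal (a := min (p + 1) s) (b := s - min (p + 1) s) (by omega)
    ((Nat.choose_le_choose 2 (by omega)).trans hp)
    ((Nat.choose_le_choose 2 (by omega)).trans hq)

end MonomialIdeal

theorem alternatingMap_mem_of_mem_span {S M ι κ : Type*} [CommRing S] [AddCommGroup M] [Module S M]
    [Fintype ι] (I : Ideal S) (z : κ → S) (w : κ → M) (f : M [⋀^ι]→ₗ[S] S)
    (hz : ∀ ν : ι → κ, Function.Injective ν → ∏ l, z (ν l) ∈ I) (v : ι → M)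
    (hv : ∀ l, v l ∈ Submodule.span S (Set.range fun n => z n • w n)) : f v ∈ I := by
  classical
  choose d hd using fun l => Finsupp.mem_span_range_iff_exists_finsupp.1 (hv l)
  have hvd : v = fun l => ∑ n ∈ (d l).support, (d l n * z n) • w n := by
    funext l
    rw [← hd l, Finsupp.sum]
    exact Finset.sum_congr rfl fun n _ => (mul_smul _ _ _).symm
  rw [hvd, ← AlternatingMap.coe_multilinearMap, MultilinearMap.map_sum_finset]
  refine Ideal.sum_mem _ fun ν _ => ?_
  rw [MultilinearMap.map_smul_univ, smul_eq_mul, Finset.prod_mul_distrib]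
  by_cases hν : Function.Injective ν
  · exact Ideal.mul_mem_right _ _ (Ideal.mul_mem_left _ _ (hz ν hν))
  · rw [AlternatingMap.coe_multilinearMap, AlternatingMap.map_eq_zero_of_not_injective f
      (fun l => w (ν l)) fun h => hν (Function.Injective.of_comp (f := w) h), mul_zero]
    exact Ideal.zero_mem _

theorem det_sub_det_mem {S ι : Type*} [CommRing S] [Fintype ι] [DecidableEq ι] (I : Ideal S)
    {M M' : Matrix ι ι S} (h : ∀ i j, M i j - M' i j ∈ I) : M.det - M'.det ∈ I := by
  rw [← Ideal.Quotient.eq, RingHom.map_det, RingHom.map_det]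
  congr 1
  ext i j
  exact Ideal.Quotient.eq.2 (h i j)

namespace SmoothingChart

variable {k S : Type*} [Field k] [CommRing S] [Algebra k S] [Algebra (PowerSeries k) S]
  (c : SmoothingChart k S) {m : ℕ}

theorem jacobson_pow_le_cornerIdeal (s : ℕ) :
    Ideal.jacobson (⊥ : Ideal S) ^ ((s + 1).choose 2 + (s + 1).choose 2) ≤
      cornerIdeal c.x c.y s := by
  refine (c.jacobson_pow_add_le _).trans (sup_le ?_ ?_) <;> rw [Ideal.span_singleton_le_iff_mem]
  · simpa using pow_mul_pow_mem_cornerIdeal (x := c.x) (y := c.y) (add_zero s)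
      (Nat.choose_le_choose 2 s.le_succ) le_rfl
  · simpa using pow_mul_pow_mem_cornerIdeal (x := c.x) (y := c.y) (zero_add s) le_rfl le_rfl

variable [IsScalarTower k (PowerSeries k) S]

theorem det_mem_cornerIdeal {s : ℕ} (e : Fin s → Module.Dual S (PrincipalParts (PowerSeries k) S m))
    (τ : Fin s → PrincipalParts (PowerSeries k) S m) :
    (Matrix.of fun i l => e i (τ l)).det ∈ cornerIdeal c.x c.y s := by
  obtain ⟨w, hw⟩ := c.exists_approx_mem_span e
  choose v hv hev using fun l => hw (τ l) ((s + 1).choose 2 + (s + 1).choose 2)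
  have hdet : (Matrix.of v).det ∈ cornerIdeal c.x c.y s :=
    alternatingMap_mem_of_mem_span _ c.weightGen w Matrix.detRowAlternating
      (fun ν hν => prod_mem_cornerIdeal hν) v hv
  have hsub := c.jacobson_pow_le_cornerIdeal s (det_sub_det_mem _
    (M := Matrix.of fun i l => e i (τ l)) (M' := (Matrix.of v).transpose) fun i l => hev l i)
  rw [Matrix.det_transpose] at hsub
  simpa using add_mem hsub hdet

theorem degeneracyIdeal_le_cornerIdeal {n : ℕ}
    (e : Module.Basis (Fin m) S (Module.Dual S (PrincipalParts (PowerSeries k) S m)))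
    (τ : Fin n → PrincipalParts (PowerSeries k) S m) :
    degeneracyIdeal e τ ≤ cornerIdeal c.x c.y (min m n) := by
  rw [degeneracyIdeal, maximalMinorsIdeal, Ideal.span_le]
  rintro _ ⟨p, q, rfl⟩
  exact c.det_mem_cornerIdeal (fun i => e (p i)) (fun l => τ (q l))

end SmoothingChart

/-! ### Colengths of ideals -/

section TwoVariables

variable {k : Type*} [Field k] {D : Set (ℕ × ℕ)} {h : MvPowerSeries (Fin 2) k}

/-- The exponent of the monomial `x ^ i y ^ j` in the variables `x = X 0` and `y = X 1`. -/
noncomputable def pairExponent (d : ℕ × ℕ) : Fin 2 →₀ ℕ :=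
  Finsupp.single 0 d.1 + Finsupp.single 1 d.2

@[simp]
theorem pairExponent_zero (d : ℕ × ℕ) : pairExponent d 0 = d.1 := by simp [pairExponent]

@[simp]
theorem pairExponent_one (d : ℕ × ℕ) : pairExponent d 1 = d.2 := by simp [pairExponent]

theorem pairExponent_apply_apply (n : Fin 2 →₀ ℕ) : pairExponent (n 0, n 1) = n := by
  ext i; fin_cases i <;> simp

theorem pairExponent_le_pairExponent {d e : ℕ × ℕ} : pairExponent d ≤ pairExponent e ↔ d ≤ e := by
  rw [Finsupp.le_def, Fin.forall_fin_two]
  simp [Prod.le_def]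

theorem pairExponent_injective : Function.Injective pairExponent := fun d e h => by
  ext
  · simpa using DFunLike.congr_fun h 0
  · simpa using DFunLike.congr_fun h 1

theorem X_pow_mul_X_pow (d : ℕ × ℕ) :
    (MvPowerSeries.X 0 : MvPowerSeries (Fin 2) k) ^ d.1 * MvPowerSeries.X 1 ^ d.2 =
      MvPowerSeries.monomial (pairExponent d) 1 := by
  rw [MvPowerSeries.X_pow_eq, MvPowerSeries.X_pow_eq, MvPowerSeries.monomial_mul_monomial, mul_one,
    pairExponent]

theorem coeff_eq_zero_of_mem_monomialIdeal
    (hh : h ∈ monomialIdeal (MvPowerSeries.X 0) (MvPowerSeries.X 1) D) {d : ℕ × ℕ}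
    (hd : ∀ e ∈ D, ¬ e ≤ d) : MvPowerSeries.coeff (pairExponent d) h = 0 := by
  classical
  induction hh using Submodule.span_induction generalizing d with
  | mem h hh =>
    obtain ⟨e, he, rfl⟩ := hh
    dsimp only
    rw [X_pow_mul_X_pow, MvPowerSeries.coeff_monomial, if_neg]
    exact fun h => hd e he (pairExponent_injective h).ge
  | zero => simp
  | add f g _ _ hf hg => rw [map_add, hf hd, hg hd, add_zero]
  | smul a f _ hf =>
    rw [smul_eq_mul, MvPowerSeries.coeff_mul]
    refine Finset.sum_eq_zero fun p hp => ?_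
    rw [← pairExponent_apply_apply p.2, hf, mul_zero]
    intro e he hle
    refine hd e he (hle.trans ?_)
    rw [← pairExponent_le_pairExponent, pairExponent_apply_apply,
      ← Finset.HasAntidiagonal.mem_antidiagonal.1 hp]
    exact le_add_self

theorem mem_monomialIdeal_of_coeff_eq_zero (hD : D.Finite)
    (hh : ∀ d, (∀ e ∈ D, ¬ e ≤ d) → MvPowerSeries.coeff (pairExponent d) h = 0) :
    h ∈ monomialIdeal (MvPowerSeries.X 0) (MvPowerSeries.X 1) D := by
  classical
  induction D, hD using Set.Finite.induction_on generalizing h with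
  | empty =>
    have hzero : h = 0 := by
      ext n
      rw [← pairExponent_apply_apply n, hh _ (by simp), map_zero]
    exact hzero ▸ Ideal.zero_mem _
  | @insert e D _ _ ih =>
    let q : MvPowerSeries (Fin 2) k := fun n => MvPowerSeries.coeff (pairExponent e + n) h
    have hq (n) : MvPowerSeries.coeff n q = MvPowerSeries.coeff (pairExponent e + n) h := rfl
    have hmem : MvPowerSeries.monomial (pairExponent e) 1 * q ∈
        monomialIdeal (MvPowerSeries.X 0) (MvPowerSeries.X 1) (insert e D) := by
      rw [← X_pow_mul_X_pow]
      exact Ideal.mul_mem_right _ _ (pow_mul_pow_mem_monomialIdeal (Set.mem_insert _ _))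
    have hsub : h - MvPowerSeries.monomial (pairExponent e) 1 * q ∈
        monomialIdeal (MvPowerSeries.X 0) (MvPowerSeries.X 1) D := by
      refine ih fun d hd => ?_
      rw [map_sub, MvPowerSeries.coeff_monomial_mul, one_mul]
      split_ifs with hle
      · rw [hq, add_tsub_cancel_of_le hle, sub_self]
      · rw [sub_zero]
        refine hh d fun e' he' => ?_
        rcases he' with rfl | he'
        · rwa [← pairExponent_le_pairExponent]
        · exact hd e' he'
    have := add_mem (Ideal.span_mono (Set.image_mono (Set.subset_insert e D)) hsub) hmem
    rwa [sub_add_cancel] at this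

end TwoVariables

theorem toENat_rank_fun_quotient {k ι : Type*} [Field k] [Fintype ι] (W : Submodule k (ι → k)) :
    Cardinal.toENat (Module.rank k ((ι → k) ⧸ W)) =
      ((Fintype.card ι - Module.finrank k W : ℕ) : ℕ∞) := by
  rw [← Module.finrank_eq_rank, Cardinal.toENat_nat, Submodule.finrank_quotient,
    Module.finrank_fintype_fun_eq_card]

namespace SmoothingChart

universe u

variable {k S : Type u} [Field k] [CommRing S] [Algebra k S] [Algebra (PowerSeries k) S]
  (c : SmoothingChart k S) {D : Set (ℕ × ℕ)} {E : Finset (ℕ × ℕ)} {I : Ideal S} {s : S}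

theorem symm_mem_monomialIdeal_iff :
    c.φ.symm s ∈ monomialIdeal (MvPowerSeries.X 0) (MvPowerSeries.X 1) D ↔
      s ∈ monomialIdeal c.x c.y D := by
  constructor
  · intro h
    have hle : monomialIdeal (MvPowerSeries.X 0) (MvPowerSeries.X 1) D ≤
        (monomialIdeal c.x c.y D).comap c.φ := by
      refine monomialIdeal_le fun d hd => ?_
      rw [Ideal.mem_comap, map_mul, map_pow, map_pow]
      exact Ideal.mem_of_dvd _ (mul_dvd_mul (pow_dvd_pow_of_dvd c.associated_x.symm.dvd _) dvd_rfl)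
        (pow_mul_pow_mem_monomialIdeal hd)
    simpa using hle h
  · intro h
    have hle : monomialIdeal c.x c.y D ≤
        (monomialIdeal (MvPowerSeries.X 0) (MvPowerSeries.X 1) D).comap c.φ.symm := by
      refine monomialIdeal_le fun d hd => ?_
      rw [Ideal.mem_comap, map_mul, map_pow, map_pow, x, y, AlgEquiv.symm_apply_apply,
        AlgEquiv.symm_apply_apply]
      exact Ideal.mem_of_dvd _ (mul_dvd_mul (pow_dvd_pow_of_dvd (dvd_mul_right _ _) _) dvd_rfl)
        (pow_mul_pow_mem_monomialIdeal hd)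
    exact hle h

variable (E) in
/-- The map sending `s` to the coefficients with exponents in `E` of the power series
`c.φ.symm s`. -/
noncomputable def coeffOn : S →ₗ[k] (E → k) :=
  LinearMap.pi fun d => MvPowerSeries.coeff (pairExponent d) ∘ₗ c.φ.symm.toLinearMap

theorem coeffOn_apply (d : E) :
    c.coeffOn E s d = MvPowerSeries.coeff (pairExponent d) (c.φ.symm s) := rfl

variable (E) in
theorem coeffOn_surjective : Function.Surjective (c.coeffOn E) := by
  classical
  intro v
  refine ⟨c.φ (∑ d : E, MvPowerSeries.monomial (pairExponent d) (v d)), ?_⟩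
  funext e
  rw [coeffOn_apply, AlgEquiv.symm_apply_apply, map_sum, Finset.sum_eq_single e]
  · rw [MvPowerSeries.coeff_monomial_same]
  · intro d _ hd
    rw [MvPowerSeries.coeff_monomial, if_neg]
    exact fun h => hd (Subtype.ext (pairExponent_injective h).symm)
  · simp

theorem coeffOn_eq_zero_of_mem_monomialIdeal (hE : ∀ d ∈ E, ∀ e ∈ D, ¬ e ≤ d)
    (hs : s ∈ monomialIdeal c.x c.y D) : c.coeffOn E s = 0 :=
  funext fun d =>
    coeff_eq_zero_of_mem_monomialIdeal (c.symm_mem_monomialIdeal_iff.2 hs) (hE d d.2)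

theorem mem_monomialIdeal_of_coeffOn_eq_zero (hD : D.Finite)
    (hE : ∀ d, (∀ e ∈ D, ¬ e ≤ d) → d ∈ E) (hs : c.coeffOn E s = 0) :
    s ∈ monomialIdeal c.x c.y D :=
  c.symm_mem_monomialIdeal_iff.1
    (mem_monomialIdeal_of_coeff_eq_zero hD fun d hd => congrFun hs ⟨d, hE d hd⟩)

theorem le_toENat_rank_quotient (W : Submodule k (E → k)) (h : ∀ s ∈ I, c.coeffOn E s ∈ W) :
    ((E.card - Module.finrank k W : ℕ) : ℕ∞) ≤ Cardinal.toENat (Module.rank k (S ⧸ I)) := by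
  rw [← Fintype.card_coe, ← toENat_rank_fun_quotient]
  refine OrderHomClass.mono Cardinal.toENat ?_
  let f : (S ⧸ I) →ₗ[k] ((E → k) ⧸ W) :=
    Submodule.liftQ (I.restrictScalars k) (W.mkQ ∘ₗ c.coeffOn E) (fun s hs => by
      simpa using h s hs) ∘ₗ
      (Submodule.Quotient.restrictScalarsEquiv k I).symm.toLinearMap
  refine LinearMap.rank_le_of_surjective f fun v => ?_
  obtain ⟨v, rfl⟩ := W.mkQ_surjective v
  obtain ⟨s, rfl⟩ := c.coeffOn_surjective E v
  exact ⟨Ideal.Quotient.mk I s, rfl⟩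

theorem toENat_rank_quotient_le (W : Submodule k (E → k)) (h : ∀ s, c.coeffOn E s ∈ W → s ∈ I) :
    Cardinal.toENat (Module.rank k (S ⧸ I)) ≤ ((E.card - Module.finrank k W : ℕ) : ℕ∞) := by
  rw [← Fintype.card_coe, ← toENat_rank_fun_quotient]
  refine OrderHomClass.mono Cardinal.toENat ?_
  have hsurj : Function.Surjective (W.mkQ ∘ₗ c.coeffOn E) :=
    W.mkQ_surjective.comp (c.coeffOn_surjective E)
  let f : (S ⧸ LinearMap.ker (W.mkQ ∘ₗ c.coeffOn E)) →ₗ[k] (S ⧸ I) :=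
    (Submodule.Quotient.restrictScalarsEquiv k I).toLinearMap ∘ₗ
      Submodule.mapQ _ (I.restrictScalars k) LinearMap.id (fun s hs => h s (by simpa using hs))
  rw [← (LinearMap.quotKerEquivOfSurjective _ hsurj).rank_eq]
  refine LinearMap.rank_le_of_surjective f fun v => ?_
  obtain ⟨s, rfl⟩ := Ideal.Quotient.mk_surjective v
  exact ⟨Submodule.Quotient.mk s, rfl⟩

end SmoothingChart

/-- The exponents of the monomials outside `cornerIdeal`, decomposed into rectangles. -/
def staircase (s : ℕ) : Finset (ℕ × ℕ) :=
  (Finset.HasAntidiagonal.antidiagonal s).biUnion fun p =>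
    Finset.Ico (p.1.choose 2) ((p.1 + 1).choose 2) ×ˢ Finset.range ((p.2 + 1).choose 2)

theorem exists_choose_two_le_and_lt (n : ℕ) : ∃ a : ℕ, a.choose 2 ≤ n ∧ n < (a + 1).choose 2 := by
  induction n with
  | zero => exact ⟨1, by simp⟩
  | succ n ih =>
    obtain ⟨a, ha, hn⟩ := ih
    rcases (Nat.succ_le_of_lt hn).lt_or_eq with hlt | heq
    · exact ⟨a, by omega, hlt⟩
    · refine ⟨a + 1, heq.ge, ?_⟩
      rw [Nat.choose_succ_succ' (a + 1) 1, Nat.choose_one_right, one_add_one_eq_two]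
      omega

theorem mem_staircase {s : ℕ} {d : ℕ × ℕ} : d ∈ staircase s ↔ ∀ e ∈ corners s, ¬ e ≤ d := by
  simp only [staircase, Finset.mem_biUnion, Prod.exists, Finset.HasAntidiagonal.mem_antidiagonal,
    Finset.mem_product, Finset.mem_Ico, Finset.mem_range]
  constructor
  · rintro ⟨a₀, b₀, hab₀, ⟨-, hd₁⟩, hd₂⟩ _ ⟨a, b, hab, rfl⟩ ⟨ha, hb⟩
    dsimp only at ha hb
    have haa₀ : a ≤ a₀ := by
      by_contra! h
      exact (ha.trans_lt hd₁).not_ge (Nat.choose_le_choose 2 h)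
    exact (hb.trans_lt hd₂).not_ge (Nat.choose_le_choose 2 (by omega))
  · intro h
    obtain ⟨a, ha, hd⟩ := exists_choose_two_le_and_lt d.1
    have has : a ≤ s := by
      by_contra! hlt
      exact h _ ⟨s, 0, by omega, rfl⟩ ⟨(Nat.choose_le_choose 2 hlt.le).trans ha, by simp⟩
    refine ⟨a, s - a, by omega, ⟨ha, hd⟩, ?_⟩
    by_contra! hle
    exact h _ ⟨a, s - a, by omega, rfl⟩ ⟨ha, hle⟩

theorem sum_antidiagonal_choose (n q : ℕ) :
    ∑ p ∈ Finset.HasAntidiagonal.antidiagonal n, p.2.choose q = (n + 1).choose (q + 1) := by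
  induction n with
  | zero => simp [Nat.choose_succ_succ']
  | succ n ih =>
    rw [Finset.Nat.sum_antidiagonal_succ, ih, Nat.choose_succ_succ' (n + 1) q]

theorem sum_antidiagonal_mul_choose (n q : ℕ) :
    ∑ p ∈ Finset.HasAntidiagonal.antidiagonal n, p.1 * p.2.choose q = (n + 1).choose (q + 2) := by
  induction n with
  | zero => simp [Nat.choose_succ_succ']
  | succ n ih =>
    rw [Finset.Nat.sum_antidiagonal_succ]
    simp only [add_mul, one_mul, zero_mul, zero_add, Finset.sum_add_distrib, ih,
      sum_antidiagonal_choose]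
    rw [Nat.choose_succ_succ' (n + 1) (q + 1), add_comm]

theorem card_staircase (s : ℕ) : (staircase s).card = (s + 2).choose 4 := by
  rw [staircase, Finset.card_biUnion, ← sum_antidiagonal_mul_choose (s + 1) 2,
    Finset.Nat.sum_antidiagonal_succ', Nat.choose_zero_succ, mul_zero, zero_add]
  · refine Finset.sum_congr rfl fun p _ => ?_
    rw [Finset.card_product, Nat.card_Ico, Finset.card_range, Nat.choose_succ_succ' p.1 1,
      Nat.choose_one_right, Nat.add_sub_cancel]
  · rintro ⟨a, b⟩ hab ⟨a', b'⟩ hab' hne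
    simp only [Finset.mem_coe, Finset.HasAntidiagonal.mem_antidiagonal] at hab hab'
    rw [Function.onFun, Finset.disjoint_left]
    rintro d hd hd'
    simp only [Finset.mem_product, Finset.mem_Ico] at hd hd'
    have hle {a a' : ℕ} (h : a < a') := Nat.choose_le_choose 2 (Nat.succ_le_of_lt h)
    rcases lt_trichotomy a a' with h | rfl | h
    · exact (hd.1.2.trans_le (hle h)).not_ge hd'.1.1
    · exact hne (by rw [show b = b' by omega])
    · exact (hd'.1.2.trans_le (hle h)).not_ge hd.1.1

namespace SmoothingChart

universe u

variable {k S : Type u} [Field k] [CommRing S] [Algebra k S] [Algebra (PowerSeries k) S]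
  (c : SmoothingChart k S) {s : ℕ} {I : Ideal S}

theorem le_toENat_rank_quotient_of_le_cornerIdeal (h : I ≤ cornerIdeal c.x c.y s) :
    (((s + 2).choose 4 : ℕ) : ℕ∞) ≤ Cardinal.toENat (Module.rank k (S ⧸ I)) := by
  have := c.le_toENat_rank_quotient (E := staircase s) ⊥ fun t ht => (Submodule.mem_bot k).2 <|
    c.coeffOn_eq_zero_of_mem_monomialIdeal (fun d hd => mem_staircase.1 hd) (h ht)
  simpa [card_staircase] using this

theorem toENat_rank_quotient_le_of_cornerIdeal_le (h : cornerIdeal c.x c.y s ≤ I) :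
    Cardinal.toENat (Module.rank k (S ⧸ I)) ≤ (((s + 2).choose 4 : ℕ) : ℕ∞) := by
  have := c.toENat_rank_quotient_le (E := staircase s) (I := I) ⊥ fun t ht =>
    h (c.mem_monomialIdeal_of_coeffOn_eq_zero (finite_corners s) (fun d hd => mem_staircase.2 hd)
      ((Submodule.mem_bot k).1 ht))
  simpa [card_staircase] using this

end SmoothingChart

/-! ### Lists with small degeneracy ideals -/

section NodeColumn

variable {S : Type*} [CommRing S]

variable (S) in
/-- The vector `(1, ν, ν ^ 2, …, ν ^ (m - 1))`, through which the dual basis reads an element of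
weight `ν`. -/
def powerVec (m : ℕ) (ν : ℤ) : Fin m → S := fun j => (ν : S) ^ (j : ℕ)

/-- The column of the degeneracy matrix at the element `x ^ i + y ^ (n - i)`, whose two summands
have weights `i` and `i - n`. -/
def nodeColumn (x y : S) (m n i : ℕ) : Fin m → S :=
  x ^ i • powerVec S m i + y ^ (n - i) • powerVec S m (i - n)

/-- The degeneracy matrix at the list `1 + y ^ n, x + y ^ (n - 1), …, x ^ (n - 1) + y`. -/
def nodeMatrix (x y : S) (m n : ℕ) : Matrix (Fin m) (Fin n) S :=
  Matrix.of fun j l => nodeColumn x y m n l j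

/-- The weight of the summand of `x ^ r l + y ^ (n - r l)` that is chosen at `l`, namely
`x ^ r l` for `l ∈ A` and `y ^ (n - r l)` for `l ∉ A`. -/
def chosenWeight {s : ℕ} (r : Fin s → ℕ) (n : ℕ) (A : Finset (Fin s)) (l : Fin s) : ℤ :=
  if l ∈ A then r l else r l - n

theorem map_nodeColumn {m n s : ℕ} (x y : S) (r : Fin s → ℕ)
    (f : MultilinearMap S (fun _ : Fin s => Fin m → S) S) :
    f (fun l => nodeColumn x y m n (r l)) = ∑ A : Finset (Fin s),
      x ^ (∑ l ∈ A, r l) * y ^ (∑ l ∈ Aᶜ, (n - r l)) *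
        f (fun l => powerVec S m (chosenWeight r n A l)) := by
  refine (f.map_add_univ (fun l => x ^ r l • powerVec S m (r l))
    (fun l => y ^ (n - r l) • powerVec S m (r l - n))).trans (Finset.sum_congr rfl fun A _ => ?_)
  have hsmul : A.piecewise (fun l => x ^ r l • powerVec S m (r l))
      (fun l => y ^ (n - r l) • powerVec S m (r l - n)) =
      fun l => A.piecewise (fun l => x ^ r l) (fun l => y ^ (n - r l)) l •
        powerVec S m (chosenWeight r n A l) := by
    funext l
    by_cases hl : l ∈ A <;> simp [hl, chosenWeight]
  rw [hsmul, MultilinearMap.map_smul_univ, Finset.prod_piecewise, Finset.univ_inter,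
    ← Finset.compl_eq_univ_sdiff, Finset.prod_pow_eq_pow_sum, Finset.prod_pow_eq_pow_sum,
    smul_eq_mul]

end NodeColumn

section Choices

variable {s n : ℕ} {r : Fin s → ℕ} {A : Finset (Fin s)}

theorem chosenWeight_injective (hr : Function.Injective r) (hn : ∀ l, r l < n)
    (A : Finset (Fin s)) : Function.Injective (chosenWeight r n A) := by
  intro i j hij
  have hi := hn i
  have hj := hn j
  unfold chosenWeight at hij
  refine hr ?_
  split_ifs at hij <;> omega

theorem injective_sub_of_lt (hr : Function.Injective r) (hn : ∀ l, r l < n) :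
    Function.Injective fun l => n - r l := fun i j hij => by
  have hi := hn i
  have hj := hn j
  exact hr (by dsimp only at hij; omega)

theorem zero_notMem_image_sub (hn : ∀ l, r l < n) (A : Finset (Fin s)) :
    0 ∉ A.image fun l => n - r l := by
  simp only [Finset.mem_image, not_exists, not_and]
  intro l _
  exact (Nat.sub_pos_of_lt (hn l)).ne'

theorem sum_eq_choose_two (hr : Function.Injective r) {a : ℕ}
    (h : A.image r = Finset.range a) : ∑ l ∈ A, r l = a.choose 2 := by
  rw [← Finset.sum_image (f := fun i => i) hr.injOn, h, Finset.sum_range_id, Nat.choose_two_right]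

theorem sum_sub_eq_choose_two (hr : Function.Injective r) (hn : ∀ l, r l < n) {b : ℕ}
    (h : insert 0 (A.image fun l => n - r l) = Finset.range b) :
    ∑ l ∈ A, (n - r l) = b.choose 2 := by
  rw [← Finset.sum_image (f := fun i => i) (injective_sub_of_lt hr hn).injOn,
    ← Finset.sum_insert_zero (f := fun i => i) (a := 0) rfl, h, Finset.sum_range_id,
    Nat.choose_two_right]

theorem image_filter_lt_eq_range {a : ℕ} (h : ∀ i < a, ∃ l, r l = i) :
    ({l | r l < a} : Finset (Fin s)).image r = Finset.range a := by
  ext i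
  simp only [Finset.mem_image, Finset.mem_filter_univ, Finset.mem_range]
  constructor
  · rintro ⟨l, hl, rfl⟩
    exact hl
  · intro hi
    obtain ⟨l, rfl⟩ := h i hi
    exact ⟨l, hi, rfl⟩

theorem insert_zero_image_compl_filter_lt_eq_range {a b : ℕ}
    (h : ∀ i < n, n ≤ i + b → a ≤ i ∧ ∃ l, r l = i) (h' : ∀ l, a ≤ r l → n ≤ r l + b)
    (hb : b ≤ n) :
    insert 0 (({l | r l < a} : Finset (Fin s))ᶜ.image fun l => n - r l) =
      Finset.range (b + 1) := by
  ext i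
  simp only [Finset.mem_insert, Finset.mem_image, Finset.mem_compl, Finset.mem_filter_univ,
    not_lt, Finset.mem_range]
  constructor
  · rintro (rfl | ⟨l, hl, rfl⟩)
    · exact b.succ_pos
    · have := h' l hl
      omega
  · intro hi
    rcases i.eq_zero_or_pos with hi' | hi'
    · exact Or.inl hi'
    · obtain ⟨ha, l, hl⟩ := h (n - i) (by omega) (by omega)
      exact Or.inr ⟨l, by omega, by omega⟩

theorem mem_iff_lt_card_of_image_eq_range (hr : Function.Injective r)
    (h : A.image r = Finset.range A.card) (l : Fin s) : l ∈ A ↔ r l < A.card := by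
  rw [← Finset.mem_range, ← h]
  simp only [Finset.mem_image, hr.eq_iff, exists_eq_right]

variable {S : Type*} [CommRing S] {x y : S}

theorem pow_mul_pow_mem_mul_cornerIdeal_or {𝔪 : Ideal S} (hx : x ∈ 𝔪) (hy : y ∈ 𝔪)
    (hr : Function.Injective r) (hn : ∀ l, r l < n) (A : Finset (Fin s)) :
    x ^ (∑ l ∈ A, r l) * y ^ (∑ l ∈ Aᶜ, (n - r l)) ∈ 𝔪 * cornerIdeal x y s ∨
      (A.image r = Finset.range A.card ∧
        insert 0 (Aᶜ.image fun l => n - r l) = Finset.range (Aᶜ.card + 1)) := by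
  have hcard : A.card + Aᶜ.card = s := by rw [Finset.card_add_card_compl, Fintype.card_fin]
  have hinj := injective_sub_of_lt hr hn
  have h0 := zero_notMem_image_sub hn Aᶜ
  have hP := choose_two_card_le_sum (A.image r)
  have hQ := choose_two_card_succ_le_sum _ h0
  have hP' := eq_range_of_sum_le_choose_two_card (A.image r)
  have hQ' := insert_zero_eq_range_of_sum_le_choose_two_card_succ _ h0
  rw [Finset.card_image_of_injective _ hr, Finset.sum_image hr.injOn] at hP hP'
  rw [Finset.card_image_of_injective _ hinj, Finset.sum_image hinj.injOn] at hQ hQ'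
  rcases hP.lt_or_eq with hlt | heq
  · obtain ⟨P, hPe⟩ := Nat.exists_eq_add_of_le' (Nat.one_le_of_lt hlt)
    rw [hPe, pow_succ', mul_assoc]
    exact Or.inl (Ideal.mul_mem_mul hx (pow_mul_pow_mem_cornerIdeal hcard (by omega) hQ))
  rcases hQ.lt_or_eq with hlt | heq'
  · obtain ⟨Q, hQe⟩ := Nat.exists_eq_add_of_le' (Nat.one_le_of_lt hlt)
    rw [hQe, pow_succ', mul_left_comm]
    exact Or.inl (Ideal.mul_mem_mul hy (pow_mul_pow_mem_cornerIdeal hcard hP (by omega)))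
  exact Or.inr ⟨hP' heq.ge, hQ' heq'.ge⟩

theorem corner_mem_of_map_nodeColumn_mem {m a b : ℕ} (hr : Function.Injective r)
    (hn : ∀ l, r l < n) {f : MultilinearMap S (fun _ : Fin s => Fin m → S) S} {K : Ideal S}
    (hK : Ideal.span {x, y} * cornerIdeal x y s ≤ K)
    (hf : f (fun l => nodeColumn x y m n (r l)) ∈ K) (hA : A.image r = Finset.range a)
    (hA' : insert 0 (Aᶜ.image fun l => n - r l) = Finset.range (b + 1))
    (hu : IsUnit (f fun l => powerVec S m (chosenWeight r n A l)))
    (hB : ∀ B ≠ A, B.image r = Finset.range B.card →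
      insert 0 (Bᶜ.image fun l => n - r l) = Finset.range (Bᶜ.card + 1) →
      x ^ B.card.choose 2 * y ^ (Bᶜ.card + 1).choose 2 *
        f (fun l => powerVec S m (chosenWeight r n B l)) ∈ K) :
    x ^ a.choose 2 * y ^ (b + 1).choose 2 ∈ K := by
  rw [map_nodeColumn, ← Finset.add_sum_erase _ _ (Finset.mem_univ A)] at hf
  rw [← sum_eq_choose_two hr hA, ← sum_sub_eq_choose_two hr hn hA']
  refine (Ideal.mul_unit_mem_iff_mem K hu).1 ((Submodule.add_mem_iff_left _ ?_).1 hf)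
  refine Ideal.sum_mem _ fun B hBA => ?_
  rcases pow_mul_pow_mem_mul_cornerIdeal_or (x := x) (y := y) (𝔪 := Ideal.span {x, y})
    (Ideal.subset_span (by simp)) (Ideal.subset_span (by simp)) hr hn B with h | ⟨h, h'⟩
  · exact Ideal.mul_mem_right _ _ (hK h)
  · rw [sum_eq_choose_two hr h, sum_sub_eq_choose_two hr hn h']
    exact hB B (Finset.ne_of_mem_erase hBA) h h'

end Choices

section NodeMatrix

variable {S : Type*} [CommRing S] {x y : S}

theorem cornerIdeal_le_of_corners_mem_sup {s : ℕ} {I : Ideal S}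
    (hx : x ∈ Ideal.jacobson (⊥ : Ideal S)) (hy : y ∈ Ideal.jacobson (⊥ : Ideal S))
    (h : ∀ a b, a + b = s → x ^ a.choose 2 * y ^ (b + 1).choose 2 ∈
      I ⊔ Ideal.span {x, y} * cornerIdeal x y s) :
    cornerIdeal x y s ≤ I := by
  refine Submodule.le_of_le_smul_of_le_jacobson_bot (I := Ideal.span {x, y}) ?_ ?_ ?_
  · exact Submodule.fg_span ((finite_corners s).image _)
  · rw [Ideal.span_le, Set.insert_subset_iff, Set.singleton_subset_iff]
    exact ⟨hx, hy⟩
  · refine monomialIdeal_le ?_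
    rintro _ ⟨a, b, hab, rfl⟩
    exact h a b hab

theorem minor_mem_maximalMinorsIdeal {m n s : ℕ} (h : min m n = s)
    (M : Matrix (Fin m) (Fin n) S) (p : Fin s ↪o Fin m) (q : Fin s ↪o Fin n) :
    (M.submatrix p q).det ∈ maximalMinorsIdeal M := by
  subst h
  exact Ideal.subset_span ⟨p, q, rfl⟩

theorem detRowAlternating_nodeColumn_mem {m n : ℕ} (h : m ≤ n) (q : Fin m ↪o Fin n) :
    Matrix.detRowAlternating (fun l => nodeColumn x y m n (q l)) ∈
      maximalMinorsIdeal (nodeMatrix x y m n) := by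
  have hmem := minor_mem_maximalMinorsIdeal (min_eq_left h) (nodeMatrix x y m n)
    (RelEmbedding.refl _) q
  rwa [← Matrix.det_transpose] at hmem

theorem cornerIdeal_le_maximalMinorsIdeal_nodeMatrix_succ (k : Type*) [Field k] [CharZero k]
    [Algebra k S] (hx : x ∈ Ideal.jacobson (⊥ : Ideal S)) (hy : y ∈ Ideal.jacobson (⊥ : Ideal S))
    (m : ℕ) : cornerIdeal x y m ≤ maximalMinorsIdeal (nodeMatrix x y m (m + 1)) := by
  refine cornerIdeal_le_of_corners_mem_sup hx hy fun a b hab => ?_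
  let o : Fin (m + 1) := ⟨a, by omega⟩
  let r : Fin m → ℕ := fun l => (o.succAbove l : ℕ)
  have hr : Function.Injective r := Fin.val_injective.comp Fin.succAbove_right_injective
  have hn : ∀ l, r l < m + 1 := fun l => (o.succAbove l).2
  have hr_ne : ∀ l, r l ≠ a := fun l h => Fin.succAbove_ne o l (Fin.ext h)
  have hr_ex : ∀ i, i < m + 1 → i ≠ a → ∃ l, r l = i := fun i hi hia => by
    obtain ⟨l, hl⟩ := Fin.exists_succAbove_eq (x := ⟨i, hi⟩) (y := o)
      (fun h => hia (congrArg Fin.val h))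
    exact ⟨l, congrArg Fin.val hl⟩
  refine corner_mem_of_map_nodeColumn_mem hr hn le_sup_right
    (f := (Matrix.detRowAlternating (R := S) (n := Fin m)).toMultilinearMap)
    (Ideal.mem_sup_left (detRowAlternating_nodeColumn_mem m.le_succ o.succAboveOrderEmb))
    (image_filter_lt_eq_range fun i hi => hr_ex i (by omega) (by omega))
    (insert_zero_image_compl_filter_lt_eq_range
      (fun i hi hib => ⟨by omega, hr_ex i hi (by omega)⟩)
      (fun l hl => by have := hr_ne l; omega) (by omega))
    (isUnit_det_vandermonde_intCast k (chosenWeight_injective hr hn _))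
    fun B hBA hB hB' => absurd ?_ hBA
  have hcard : B.card + Bᶜ.card = m := by rw [Finset.card_add_card_compl, Fintype.card_fin]
  have h : a ∉ B.image r := by
    simpa only [Finset.mem_image, not_exists, not_and] using fun l _ => hr_ne l
  have h' : m + 1 - a ∉ insert 0 (Bᶜ.image fun l => m + 1 - r l) := by
    simp only [Finset.mem_insert, Finset.mem_image, not_or, not_exists, not_and]
    exact ⟨by omega, fun l _ hl => hr_ne l (by have := hn l; omega)⟩
  rw [hB, Finset.mem_range] at h
  rw [hB', Finset.mem_range] at h'
  ext l
  rw [mem_iff_lt_card_of_image_eq_range hr hB, Finset.mem_filter_univ,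
    show B.card = a by omega]

theorem detRowAlternating_curryLeft_nodeColumn_mem (s : ℕ) (w : Fin (s + 1) → S) :
    Matrix.detRowAlternating.curryLeft w (fun l : Fin s => nodeColumn x y (s + 1) s l) ∈
      maximalMinorsIdeal (nodeMatrix x y (s + 1) s) := by
  change (Matrix.of (Fin.cons w fun l : Fin s => nodeColumn x y (s + 1) s l :
    Fin (s + 1) → Fin (s + 1) → S)).det ∈ _
  rw [Matrix.det_succ_row_zero]
  refine Ideal.sum_mem _ fun j _ => Ideal.mul_mem_left _ _ ?_
  have hmem := minor_mem_maximalMinorsIdeal (min_eq_right s.le_succ) (nodeMatrix x y (s + 1) s)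
    j.succAboveOrderEmb (RelEmbedding.refl _)
  rwa [← Matrix.det_transpose] at hmem

theorem isUnit_detRowAlternating_curryLeft (k : Type*) [Field k] [CharZero k] [Algebra k S]
    {s : ℕ} {ν : ℤ} {μ : Fin s → ℤ} (hμ : Function.Injective μ) (hν : ν ∉ Set.range μ) :
    IsUnit (Matrix.detRowAlternating.curryLeft (powerVec S (s + 1) ν)
      fun l => powerVec S (s + 1) (μ l)) := by
  have hrows : (Fin.cons (powerVec S (s + 1) ν) fun l => powerVec S (s + 1) (μ l) :
      Fin (s + 1) → Fin (s + 1) → S) =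
      fun l => powerVec S (s + 1) ((Fin.cons ν μ : Fin (s + 1) → ℤ) l) :=
    funext (Fin.cases rfl fun _ => rfl)
  change IsUnit (Matrix.of (Fin.cons (powerVec S (s + 1) ν) fun l => powerVec S (s + 1) (μ l) :
    Fin (s + 1) → Fin (s + 1) → S)).det
  rw [hrows]
  exact isUnit_det_vandermonde_intCast k (Fin.cons_injective_iff.2 ⟨hν, hμ⟩)

theorem cornerIdeal_le_maximalMinorsIdeal_nodeMatrix_pred (k : Type*) [Field k] [CharZero k]
    [Algebra k S] (hx : x ∈ Ideal.jacobson (⊥ : Ideal S)) (hy : y ∈ Ideal.jacobson (⊥ : Ideal S))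
    (s : ℕ) : cornerIdeal x y s ≤ maximalMinorsIdeal (nodeMatrix x y (s + 1) s) := by
  refine cornerIdeal_le_of_corners_mem_sup hx hy fun a => ?_
  induction a using Nat.strong_induction_on with
  | _ a ih =>
  intro b hab
  let r : Fin s → ℕ := fun l => (l : ℕ)
  have hr : Function.Injective r := Fin.val_injective
  have hn : ∀ l, r l < s := fun l => l.2
  have hr_ex : ∀ i < s, ∃ l, r l = i := fun i hi => ⟨⟨i, hi⟩, rfl⟩
  let w : Fin (s + 1) → S := powerVec S (s + 1) (a : ℕ)
  refine corner_mem_of_map_nodeColumn_mem hr hn le_sup_right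
    (f := ((Matrix.detRowAlternating (R := S) (n := Fin (s + 1))).curryLeft w).toMultilinearMap)
    (Ideal.mem_sup_left (detRowAlternating_curryLeft_nodeColumn_mem s w))
    (image_filter_lt_eq_range fun i hi => hr_ex i (by omega))
    (insert_zero_image_compl_filter_lt_eq_range
      (fun i hi hib => ⟨by omega, hr_ex i hi⟩) (fun l hl => by omega) (by omega))
    (isUnit_detRowAlternating_curryLeft k (chosenWeight_injective hr hn _) ?_)
    fun B hBA hB _ => ?_
  · rintro ⟨l, hl⟩
    have := hn l
    simp only [chosenWeight, Finset.mem_filter_univ] at hl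
    split_ifs at hl <;> omega
  have hcard : B.card + Bᶜ.card = s := by rw [Finset.card_add_card_compl, Fintype.card_fin]
  have hmem := mem_iff_lt_card_of_image_eq_range hr hB
  rcases lt_trichotomy B.card a with hlt | heq | hgt
  · exact Ideal.mul_mem_right _ _ (ih B.card hlt Bᶜ.card hcard)
  · refine absurd (Finset.ext fun l => ?_) hBA
    rw [hmem, heq, Finset.mem_filter_univ]
  · obtain ⟨l, hl⟩ := hr_ex a (by omega)
    have hw : w = powerVec S (s + 1) (chosenWeight r s B l) := by
      rw [chosenWeight, if_pos ((hmem l).2 (hl ▸ hgt)), hl]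
    convert Ideal.zero_mem _
    refine mul_eq_zero_of_right _ (Matrix.det_zero_of_row_eq (i := 0) (j := l.succ)
      (Fin.succ_ne_zero _).symm ?_)
    exact hw

theorem mul_dvd_pow_mul_pow {m : ℕ} {A : Finset (Fin m)}
    (hm : A ≠ ({l | (l : ℕ) < m} : Finset (Fin m)))
    (h1 : A ≠ ({l | (l : ℕ) < 1} : Finset (Fin m)))
    (h0 : A ≠ ({l | (l : ℕ) < 0} : Finset (Fin m))) :
    x * y ∣ x ^ (∑ l ∈ A, (l : ℕ)) * y ^ (∑ l ∈ Aᶜ, (m - l)) := by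
  refine mul_dvd_mul (dvd_pow_self x fun h => ?_) (dvd_pow_self y fun h => hm ?_)
  · rw [Finset.sum_eq_zero_iff] at h
    obtain ⟨i, hi⟩ : A.Nonempty := Finset.nonempty_iff_ne_empty.2 (by simpa using h0)
    refine h1 (Finset.ext fun l => ?_)
    rw [Finset.mem_filter_univ, Nat.lt_one_iff]
    exact ⟨h l, fun hl => Fin.ext (hl.trans (h i hi).symm) ▸ hi⟩
  · rw [Finset.sum_eq_zero_iff] at h
    refine Finset.ext fun l => ?_
    rw [Finset.mem_filter_univ]
    refine ⟨fun _ => l.2, fun _ => of_not_not fun hl => ?_⟩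
    exact (Nat.sub_pos_of_lt l.2).ne' (h l (Finset.mem_compl.2 hl))

theorem pow_mul_pow_filter_lt {m a b : ℕ} (hab : a + b = m) :
    x ^ (∑ l ∈ ({l | (l : ℕ) < a} : Finset (Fin m)), (l : ℕ)) *
      y ^ (∑ l ∈ ({l | (l : ℕ) < a} : Finset (Fin m))ᶜ, (m - l)) =
        x ^ a.choose 2 * y ^ (b + 1).choose 2 := by
  have hr_ex : ∀ i < m, ∃ l : Fin m, (l : ℕ) = i := fun i hi => ⟨⟨i, hi⟩, rfl⟩
  congr 2
  · exact sum_eq_choose_two Fin.val_injective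
      (image_filter_lt_eq_range fun i hi => hr_ex i (by omega))
  · exact sum_sub_eq_choose_two Fin.val_injective (fun l => l.2)
      (insert_zero_image_compl_filter_lt_eq_range
        (fun i hi hib => ⟨by omega, hr_ex i hi⟩) (fun l hl => by omega) (by omega))

theorem isUnit_add_mul_of_mem_jacobson {u a : S} (hu : IsUnit u)
    (ha : a ∈ Ideal.jacobson (⊥ : Ideal S)) (b : S) : IsUnit (u + a * b) := by
  obtain ⟨u, rfl⟩ := hu
  have := (Ideal.mem_jacobson_bot.1 ha (b * ↑u⁻¹)).mul u.isUnit
  rwa [add_mul, one_mul, mul_assoc, mul_assoc, Units.inv_mul, mul_one, add_comm] at this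

theorem exists_det_nodeMatrix_eq (k : Type*) [Field k] [CharZero k] [Algebra k S]
    (hy : y ∈ Ideal.jacobson (⊥ : Ideal S)) {m : ℕ} (hm : 2 ≤ m) :
    ∃ α β h : S, IsUnit α ∧ IsUnit β ∧
      (nodeMatrix x y m m).det = α * x ^ m.choose 2 + β * y ^ m.choose 2 + x * y * h := by
  classical
  let B : ℕ → Finset (Fin m) := fun a => {l | (l : ℕ) < a}
  have hmem : ∀ a (l : Fin m), l ∈ B a ↔ (l : ℕ) < a := fun a l => Finset.mem_filter_univ l
  let f := (Matrix.detRowAlternating (R := S) (n := Fin m)).toMultilinearMap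
  let u : Finset (Fin m) → S := fun A => f fun l => powerVec S m (chosenWeight (↑) m A l)
  have hu : ∀ A, IsUnit (u A) := fun A =>
    isUnit_det_vandermonde_intCast k (chosenWeight_injective Fin.val_injective (fun l => l.2) A)
  have hB : ∀ {a b}, a < b → b ≤ m → B b ≠ B a := fun {a b} hab hbm h =>
    lt_irrefl a ((hmem a ⟨a, by omega⟩).1 (h ▸ (hmem b ⟨a, by omega⟩).2 hab))
  have hdvd : ∀ A ∈ Finset.univ \ {B m, B 1, B 0}, x * y ∣
      x ^ (∑ l ∈ A, (l : ℕ)) * y ^ (∑ l ∈ Aᶜ, (m - l)) * u A := fun A hA => by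
    simp only [Finset.mem_sdiff, Finset.mem_univ, true_and, Finset.mem_insert,
      Finset.mem_singleton, not_or] at hA
    exact (mul_dvd_pow_mul_pow hA.1 hA.2.1 hA.2.2).mul_right _
  obtain ⟨h, hh⟩ := Finset.dvd_sum hdvd
  refine ⟨u (B m), u (B 1) + y ^ m * u (B 0), h, hu _,
    isUnit_add_mul_of_mem_jacobson (hu _) (Ideal.pow_mem_of_mem _ hy _ (by omega)) _, ?_⟩
  rw [← Matrix.det_transpose]
  refine (map_nodeColumn x y (fun l : Fin m => (l : ℕ)) f).trans ?_
  rw [← Finset.sum_sdiff (Finset.subset_univ {B m, B 1, B 0})]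
  refine (congrArg (· + _) hh).trans ?_
  have hBm : B m ∉ ({B 1, B 0} : Finset (Finset (Fin m))) := by
    simpa using ⟨hB hm le_rfl, hB (by omega) le_rfl⟩
  rw [Finset.sum_insert hBm, Finset.sum_pair (hB one_pos (by omega)),
    pow_mul_pow_filter_lt (add_zero m), pow_mul_pow_filter_lt (Nat.add_sub_cancel' (by omega)),
    pow_mul_pow_filter_lt (zero_add m), Nat.sub_add_cancel (by omega), Nat.choose_succ_succ' m 1,
    Nat.choose_one_right, zero_add, Nat.choose_eq_zero_of_lt one_lt_two,
    Nat.choose_eq_zero_of_lt zero_lt_two, pow_zero, pow_zero]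
  ring

end NodeMatrix

namespace SmoothingChart

variable {k S : Type*} [Field k] [CharZero k] [CommRing S] [Algebra k S] [Algebra (PowerSeries k) S]
  [IsScalarTower k (PowerSeries k) S] (c : SmoothingChart k S)

theorem exists_degeneracyIdeal_eq_nodeMatrix (m n : ℕ) :
    ∃ (e : Module.Basis (Fin m) S (Module.Dual S (PrincipalParts (PowerSeries k) S m)))
      (τ : Fin n → PrincipalParts (PowerSeries k) S m),
      degeneracyIdeal e τ = maximalMinorsIdeal (nodeMatrix c.x c.y m n) := by
  obtain ⟨e, he⟩ := c.exists_basis_dual_jet_weightGen_eq (m := m)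
  refine ⟨e, fun l => jet (PowerSeries k) m (c.weightGen (l : ℕ)) +
    jet (PowerSeries k) m (c.weightGen (-((n - l : ℕ) : ℤ))), ?_⟩
  rw [degeneracyIdeal]
  congr 1
  ext j l
  rw [Matrix.of_apply, map_add, he, he, weightGen_natCast, weightGen_neg_natCast,
    Nat.cast_sub l.2.le, neg_sub, mul_comm, mul_comm (_ ^ _) (c.y ^ _)]
  rfl

end SmoothingChart

/-! ### Lists of length `m` -/

theorem maximalMinorsIdeal_square {S : Type*} [CommRing S] {m : ℕ} (M : Matrix (Fin m) (Fin m) S) :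
    maximalMinorsIdeal M = Ideal.span {M.det} := by
  have hid (p : Fin m ↪o Fin m) : (p : Fin m → Fin m) = id :=
    (p.strictMono.range_inj strictMono_id).1 (by
      rw [(Finite.surjective_of_injective p.injective).range_eq, Set.range_id])
  have hminor : ∀ s, s = m → ∀ p q : Fin s ↪o Fin m, (M.submatrix p q).det = M.det := by
    rintro s rfl p q
    rw [hid p, hid q, Matrix.submatrix_id_id]
  refine le_antisymm (Ideal.span_le.2 ?_) ?_
  · rintro _ ⟨p, q, rfl⟩
    rw [hminor _ (min_self m)]
    exact Ideal.mem_span_singleton_self _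
  · rw [Ideal.span_singleton_le_iff_mem]
    exact minor_mem_maximalMinorsIdeal (min_self m) M (RelEmbedding.refl _) (RelEmbedding.refl _)

theorem two_mul_choose_two (m : ℕ) : 2 * m.choose 2 = m * (m - 1) := by
  rw [Nat.choose_two_right, Nat.mul_div_cancel' (Nat.even_mul_pred_self m).two_dvd]

/-- The exponents of the monomials `x ^ i` and `y ^ i` with `i ≤ N`. -/
def axes (N : ℕ) : Finset (ℕ × ℕ) :=
  (Finset.range (N + 1)).image (fun i => (i, 0)) ∪ (Finset.range N).image fun i => (0, i + 1)

/-- The minimal exponents outside `axes N`. -/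
def axesCorners (N : ℕ) : Set (ℕ × ℕ) := {(1, 1), (N + 1, 0), (0, N + 1)}

theorem finite_axesCorners (N : ℕ) : (axesCorners N).Finite := by
  rw [axesCorners]
  exact Set.toFinite _

theorem mem_axes {N : ℕ} {d : ℕ × ℕ} : d ∈ axes N ↔ ∀ e ∈ axesCorners N, ¬ e ≤ d := by
  obtain ⟨i, j⟩ := d
  simp only [axes, axesCorners, Finset.mem_union, Finset.mem_image, Finset.mem_range,
    Prod.mk.injEq, Set.mem_insert_iff, Set.mem_singleton_iff, forall_eq_or_imp, forall_eq,
    Prod.mk_le_mk]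
  constructor
  · rintro (⟨i', h, rfl, rfl⟩ | ⟨j', h, rfl, rfl⟩) <;> omega
  · rintro ⟨h1, h2, h3⟩
    rcases Nat.eq_zero_or_pos j with rfl | hj
    · exact Or.inl ⟨i, by omega, rfl, rfl⟩
    · exact Or.inr ⟨j - 1, by omega, by omega, by omega⟩

theorem card_axes (N : ℕ) : (axes N).card = 2 * N + 1 := by
  rw [axes, Finset.card_union_of_disjoint, Finset.card_image_of_injective,
    Finset.card_image_of_injective, Finset.card_range, Finset.card_range]
  · omega
  · exact fun i j h => by simpa using h
  · exact fun i j h => by simpa using h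
  · simp [Finset.disjoint_left]

section AxesCorners

variable {S : Type*} [CommRing S] {x y g : S} {N m : ℕ}

theorem pow_mul_pow_mem_monomialIdeal_axesCorners {i j : ℕ}
    (h : (1 ≤ i ∧ 1 ≤ j) ∨ N + 1 ≤ i ∨ N + 1 ≤ j) :
    x ^ i * y ^ j ∈ monomialIdeal x y (axesCorners N) := by
  have hmem {d : ℕ × ℕ} (hd : d ∈ axesCorners N) (hle : d ≤ (i, j)) :
      x ^ i * y ^ j ∈ monomialIdeal x y (axesCorners N) :=
    Ideal.mem_of_dvd _ (mul_dvd_mul (pow_dvd_pow x hle.1) (pow_dvd_pow y hle.2))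
      (pow_mul_pow_mem_monomialIdeal hd)
  rcases h with ⟨hi, hj⟩ | hi | hj
  · exact hmem (d := (1, 1)) (by simp [axesCorners]) ⟨hi, hj⟩
  · exact hmem (d := (N + 1, 0)) (by simp [axesCorners]) ⟨hi, j.zero_le⟩
  · exact hmem (d := (0, N + 1)) (by simp [axesCorners]) ⟨i.zero_le, hj⟩

theorem monomialIdeal_axesCorners_le {I : Ideal S} (hxy : x * y ∈ I) (hx : x ^ (N + 1) ∈ I)
    (hy : y ^ (N + 1) ∈ I) : monomialIdeal x y (axesCorners N) ≤ I := by
  refine monomialIdeal_le ?_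
  simpa [axesCorners] using ⟨hxy, hx, hy⟩

theorem x_mul_mem_and_y_mul_mem_of_mem_cornerIdeal (hg : g ∈ cornerIdeal x y m) :
    x * g ∈ monomialIdeal x y (axesCorners (m.choose 2)) ∧
      y * g ∈ monomialIdeal x y (axesCorners (m.choose 2)) := by
  induction hg using Submodule.span_induction with
  | mem g hg =>
    obtain ⟨_, ⟨a, b, rfl, rfl⟩, rfl⟩ := hg
    have hpos {i : ℕ} (hi : 2 ≤ i) : 1 ≤ i.choose 2 := Nat.choose_pos hi
    dsimp only
    rw [← mul_assoc, ← pow_succ', mul_left_comm, ← pow_succ']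
    constructor <;> apply pow_mul_pow_mem_monomialIdeal_axesCorners
    · rcases b.eq_zero_or_pos with rfl | hb
      · simp
      · exact Or.inl ⟨by omega, hpos (by omega)⟩
    · rcases lt_or_ge a 2 with ha | ha
      · exact Or.inr (Or.inr (Nat.succ_le_succ (Nat.choose_le_choose 2 (by omega))))
      · exact Or.inl ⟨hpos ha, by omega⟩
  | zero => simp
  | add f g _ _ hf hg =>
    rw [mul_add, mul_add]
    exact ⟨add_mem hf.1 hg.1, add_mem hf.2 hg.2⟩
  | smul a f _ hf =>
    rw [smul_eq_mul, mul_left_comm x, mul_left_comm y]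
    exact ⟨Ideal.mul_mem_left _ _ hf.1, Ideal.mul_mem_left _ _ hf.2⟩

theorem monomialIdeal_axesCorners_le_span_sup_span {α β h : S} (hα : IsUnit α) (hβ : IsUnit β)
    (hg : g = α * x ^ (N + 1) + β * y ^ (N + 1) + x * y * h) :
    monomialIdeal x y (axesCorners (N + 1)) ≤ Ideal.span {x * y} ⊔ Ideal.span {g} := by
  have hxy := Ideal.mem_span_singleton_self (x * y)
  have hgg := Ideal.mem_span_singleton_self g
  refine monomialIdeal_axesCorners_le (Ideal.mem_sup_left hxy)
    ((Ideal.unit_mul_mem_iff_mem _ hα).1 ?_) ((Ideal.unit_mul_mem_iff_mem _ hβ).1 ?_)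
  · refine Submodule.mem_sup.2 ⟨_, Ideal.mul_mem_left _ (-(β * y ^ N + x * h)) hxy, _,
      Ideal.mul_mem_left _ x hgg, ?_⟩
    rw [hg]
    ring
  · refine Submodule.mem_sup.2 ⟨_, Ideal.mul_mem_left _ (-(α * x ^ N + y * h)) hxy, _,
      Ideal.mul_mem_left _ y hgg, ?_⟩
    rw [hg]
    ring

end AxesCorners

namespace SmoothingChart

universe u

variable {k S : Type u} [Field k] [CommRing S] [Algebra k S] [Algebra (PowerSeries k) S]
  (c : SmoothingChart k S) {g : S}

theorem le_toENat_rank_quotient_of_mem_cornerIdeal {m : ℕ} (hg : g ∈ cornerIdeal c.x c.y m) :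
    ((m * (m - 1) : ℕ) : ℕ∞) ≤
      Cardinal.toENat (Module.rank k (S ⧸ (Ideal.span {c.x * c.y} ⊔ Ideal.span {g}))) := by
  obtain ⟨hxg, hyg⟩ := x_mul_mem_and_y_mul_mem_of_mem_cornerIdeal hg
  have hxy : c.x * c.y ∈ monomialIdeal c.x c.y (axesCorners (m.choose 2)) := by
    simpa using pow_mul_pow_mem_monomialIdeal_axesCorners (i := 1) (j := 1) (x := c.x) (y := c.y)
      (Or.inl ⟨le_rfl, le_rfl⟩)
  have hzero : ∀ t ∈ monomialIdeal c.x c.y (axesCorners (m.choose 2)),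
      c.coeffOn (axes (m.choose 2)) t = 0 := fun _ =>
    c.coeffOn_eq_zero_of_mem_monomialIdeal fun _ hd => mem_axes.1 hd
  refine le_trans ?_ (c.le_toENat_rank_quotient
    (Submodule.span k {c.coeffOn (axes (m.choose 2)) g}) fun t ht => ?_)
  · have hle : Module.finrank k (Submodule.span k {c.coeffOn (axes (m.choose 2)) g}) ≤ 1 := by
      simpa using finrank_span_le_card (R := k) {c.coeffOn (axes (m.choose 2)) g}
    rw [card_axes, ← two_mul_choose_two]
    exact_mod_cast by omega
  · obtain ⟨p, _, hq, rfl⟩ := Ideal.mem_span_singleton_sup.1 ht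
    obtain ⟨q, rfl⟩ := Ideal.mem_span_singleton'.1 hq
    obtain ⟨a, q', r, rfl⟩ := c.exists_eq_algebraMap_add q
    have hsplit : p * (c.x * c.y) + (algebraMap k S a + c.x * q' + c.y * r) * g =
        (p * (c.x * c.y) + q' * (c.x * g) + r * (c.y * g)) + a • g := by
      rw [Algebra.smul_def]
      ring
    rw [hsplit, map_add, map_smul, hzero (_ + _), zero_add]
    · exact Submodule.smul_mem _ _ (Submodule.mem_span_singleton_self _)
    · exact add_mem (add_mem (Ideal.mul_mem_left _ _ hxy) (Ideal.mul_mem_left _ _ hxg))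
        (Ideal.mul_mem_left _ _ hyg)

theorem x_pow_notMem_span (n : ℕ) : c.x ^ n ∉ Ideal.span {c.x ^ (n + 1), c.y} := by
  have := c.isDomain
  rw [Ideal.mem_span_pair]
  rintro ⟨u, v, huv⟩
  have hdvd : c.y ∣ c.x ^ n * (1 + c.x * -u) := ⟨v, by linear_combination -huv⟩
  rcases c.prime_y.dvd_or_dvd hdvd with h | h
  · exact c.not_y_dvd_x (c.prime_y.dvd_of_dvd_pow h)
  · exact c.prime_y.not_isUnit
      (isUnit_of_dvd_unit h (isUnit_add_mul_of_mem_jacobson isUnit_one c.x_mem_jacobson (-u)))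

theorem toENat_rank_quotient_le_of_eq {N : ℕ} (hN : 1 ≤ N) {α β h : S} (hα : IsUnit α)
    (hβ : IsUnit β) (hg : g = α * c.x ^ N + β * c.y ^ N + c.x * c.y * h) :
    Cardinal.toENat (Module.rank k (S ⧸ (Ideal.span {c.x * c.y} ⊔ Ideal.span {g}))) ≤
      ((2 * N : ℕ) : ℕ∞) := by
  obtain ⟨N, rfl⟩ := Nat.exists_eq_add_of_le' hN
  have hmem {t : S} : c.coeffOn (axes (N + 1)) t = 0 →
      t ∈ monomialIdeal c.x c.y (axesCorners (N + 1)) :=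
    c.mem_monomialIdeal_of_coeffOn_eq_zero (finite_axesCorners _) fun d hd => mem_axes.2 hd
  have hne : c.coeffOn (axes (N + 1)) g ≠ 0 := by
    intro h0
    have hle : monomialIdeal c.x c.y (axesCorners (N + 1)) ≤
        Ideal.span {c.x ^ (N + 1 + 1), c.y} :=
      monomialIdeal_axesCorners_le (Ideal.mem_span_pair.2 ⟨0, c.x, by ring⟩)
        (Ideal.subset_span (by simp)) (Ideal.mem_span_pair.2 ⟨0, c.y ^ (N + 1), by ring⟩)
    have hx : α * c.x ^ (N + 1) = g - (β * c.y ^ N + c.x * h) * c.y := by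
      rw [hg]
      ring
    refine c.x_pow_notMem_span (N + 1) ((Ideal.unit_mul_mem_iff_mem _ hα).1 (hx ▸ ?_))
    exact sub_mem (hle (hmem h0)) (Ideal.mul_mem_left _ _ (Ideal.subset_span (by simp)))
  refine (c.toENat_rank_quotient_le (Submodule.span k {c.coeffOn (axes (N + 1)) g})
    fun t ht => ?_).trans ?_
  · obtain ⟨a, ha⟩ := Submodule.mem_span_singleton.1 ht
    have hsub : t - a • g ∈ monomialIdeal c.x c.y (axesCorners (N + 1)) :=
      hmem (by rw [map_sub, map_smul, ha, sub_self])
    have := add_mem (monomialIdeal_axesCorners_le_span_sup_span hα hβ hg hsub)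
      (Submodule.smul_of_tower_mem _ a (Ideal.mem_sup_right (Ideal.mem_span_singleton_self g)))
    rwa [sub_add_cancel] at this
  · rw [finrank_span_singleton hne, card_axes, Nat.add_sub_cancel]

end SmoothingChart

/-! ### The generic fibre -/

theorem isPrecomplete_of_finite {R M : Type*} [CommRing R] [AddCommGroup M] [Module R M]
    (I : Ideal R) [IsPrecomplete I R] [Module.Finite R M] : IsPrecomplete I M := by
  rw [← AdicCompletion.of_surjective_iff]
  intro z
  obtain ⟨t, rfl⟩ := AdicCompletion.ofTensorProduct_surjective_of_finite I M z
  induction t using TensorProduct.induction_on with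
  | zero => exact ⟨0, by simp⟩
  | tmul r m =>
    obtain ⟨r, rfl⟩ := AdicCompletion.of_surjective I R r
    refine ⟨r • m, ?_⟩
    rw [AdicCompletion.ofTensorProduct_tmul, map_smul]
    rfl
  | add s t hs ht =>
    obtain ⟨a, ha⟩ := hs
    obtain ⟨b, hb⟩ := ht
    exact ⟨a + b, by rw [map_add, map_add, ha, hb]⟩

section Reduction

variable {R Q W ι : Type*} [CommRing R] [AddCommGroup Q] [Module R Q] [Module (PowerSeries R) Q]
  [IsScalarTower R (PowerSeries R) Q] [AddCommGroup W] [Module R W] {f : Q →ₗ[R] W}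

theorem map_powerSeries_smul (hX : ∀ q, f ((PowerSeries.X : PowerSeries R) • q) = 0)
    (a : PowerSeries R) (q : Q) : f (a • q) = PowerSeries.constantCoeff a • f q := by
  conv_lhs => rw [PowerSeries.eq_X_mul_shift_add_const a, add_smul, map_add, mul_smul, hX, zero_add,
    PowerSeries.C_eq_algebraMap, algebraMap_smul, map_smul]

theorem linearIndependent_of_reduction (hX : ∀ q, f ((PowerSeries.X : PowerSeries R) • q) = 0)
    (hreg : ∀ q : Q, (PowerSeries.X : PowerSeries R) • q = 0 → q = 0) {b : ι → Q}
    (hb : LinearIndependent R (f ∘ b)) : LinearIndependent (PowerSeries R) b := by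
  rw [linearIndependent_iff'] at hb ⊢
  intro t a ha i hi
  have hpow (n : ℕ) : ∃ a' : ι → PowerSeries R,
      (∀ i ∈ t, a i = PowerSeries.X ^ n * a' i) ∧ ∑ i ∈ t, a' i • b i = 0 := by
    induction n with
    | zero => exact ⟨a, by simp, ha⟩
    | succ n ih =>
      obtain ⟨a', haa', ha'⟩ := ih
      have hconst : ∀ i ∈ t, PowerSeries.constantCoeff (a' i) = 0 :=
        hb t _ (by simpa [map_powerSeries_smul hX] using congrArg f ha')
      choose! c hc using fun i hi => PowerSeries.X_dvd_iff.2 (hconst i hi)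
      refine ⟨c, fun i hi => by rw [haa' i hi, hc i hi, pow_succ, mul_assoc], hreg _ ?_⟩
      rw [Finset.smul_sum, ← ha']
      exact Finset.sum_congr rfl fun i hi => by rw [hc i hi, mul_smul]
  ext n
  obtain ⟨a', haa', -⟩ := hpow (n + 1)
  rw [haa' i hi, map_zero]
  exact PowerSeries.X_pow_dvd_iff.1 (dvd_mul_right _ _) n n.lt_succ_self

theorem nonempty_basis_of_reduction [Finite ι]
    [IsHausdorff (Ideal.span {PowerSeries.X} : Ideal (PowerSeries R)) Q]
    (hf : Function.Surjective f)
    (hker : ∀ q, f q = 0 ↔ ∃ q', (PowerSeries.X : PowerSeries R) • q' = q)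
    (hreg : ∀ q : Q, (PowerSeries.X : PowerSeries R) • q = 0 → q = 0)
    (B : Module.Basis ι R W) : Nonempty (Module.Basis ι (PowerSeries R) Q) := by
  have := Fintype.ofFinite ι
  have hX : ∀ q, f ((PowerSeries.X : PowerSeries R) • q) = 0 := fun q => (hker _).2 ⟨q, rfl⟩
  choose b hb using fun i => hf (B i)
  have hfb : f ∘ b = B := funext hb
  have hspan : Function.Surjective (Fintype.linearCombination (PowerSeries R) b) := by
    have := isPrecomplete_of_finite (M := ι → PowerSeries R)
      (Ideal.span {(PowerSeries.X : PowerSeries R)})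
    refine surjective_of_mkQ_comp_surjective (I := Ideal.span {PowerSeries.X}) fun q => ?_
    obtain ⟨q, rfl⟩ := Submodule.mkQ_surjective _ q
    let a (i : ι) : PowerSeries R := PowerSeries.C (B.repr (f q) i)
    obtain ⟨q', hq'⟩ := (hker (Fintype.linearCombination (PowerSeries R) b a - q)).1 (by
      simp [a, Fintype.linearCombination_apply, map_powerSeries_smul hX, hb, B.sum_repr])
    refine ⟨a, ?_⟩
    rw [LinearMap.comp_apply, ← sub_eq_zero, ← map_sub, Submodule.mkQ_apply,
      Submodule.Quotient.mk_eq_zero, Submodule.ideal_span_singleton_smul,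
      Submodule.mem_smul_pointwise_iff_exists]
    exact ⟨q', trivial, hq'⟩
  refine ⟨Module.Basis.mk
    (linearIndependent_of_reduction hX hreg (hfb ▸ B.linearIndependent)) ?_⟩
  rw [← Fintype.range_linearCombination, LinearMap.range_eq_top.2 hspan]

end Reduction

namespace SmoothingChart

universe u

variable {k S : Type u} [Field k] [CommRing S] [Algebra k S] [Algebra (PowerSeries k) S]
  (c : SmoothingChart k S) {g : S}

theorem toENat_rank_quotient_eq_top_of_le {D : Set (ℕ × ℕ)} {I : Ideal S}
    (hI : I ≤ monomialIdeal c.x c.y D) {d : ℕ → ℕ × ℕ} (hd : Function.Injective d)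
    (hD : ∀ n, ∀ e ∈ D, ¬ e ≤ d n) : Cardinal.toENat (Module.rank k (S ⧸ I)) = ⊤ := by
  rw [ENat.eq_top_iff_forall_ge]
  intro n
  have := c.le_toENat_rank_quotient (E := (Finset.range n).map ⟨d, hd⟩) ⊥ fun s hs =>
    (Submodule.mem_bot k).2 (c.coeffOn_eq_zero_of_mem_monomialIdeal (by simpa using fun i _ => hD i)
      (hI hs))
  simpa using this

theorem not_x_dvd_of_toENat_rank_quotient_ne_top (h : Cardinal.toENat
    (Module.rank k (S ⧸ (Ideal.span {c.x * c.y} ⊔ Ideal.span {g}))) ≠ ⊤) : ¬ c.x ∣ g := by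
  refine fun hg => h (c.toENat_rank_quotient_eq_top_of_le (D := {(1, 0)}) ?_
    (Prod.mk_right_injective 0) (by simp))
  simpa [monomialIdeal, Ideal.mem_span_singleton] using hg

theorem not_y_dvd_of_toENat_rank_quotient_ne_top (h : Cardinal.toENat
    (Module.rank k (S ⧸ (Ideal.span {c.x * c.y} ⊔ Ideal.span {g}))) ≠ ⊤) : ¬ c.y ∣ g := by
  refine fun hg => h (c.toENat_rank_quotient_eq_top_of_le (D := {(0, 1)}) ?_
    (Prod.mk_left_injective 0) (by simp))
  simpa [monomialIdeal, Ideal.mem_span_singleton] using hg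

theorem dvd_of_dvd_x_mul_y_mul {s : S} (hx : ¬ c.x ∣ g) (hy : ¬ c.y ∣ g)
    (h : g ∣ c.x * c.y * s) : g ∣ s := by
  have := c.isDomain
  obtain ⟨u, hu⟩ := h
  obtain ⟨v, rfl⟩ := (c.prime_x.dvd_or_dvd
    (⟨c.y * s, by rw [← hu, mul_assoc]⟩ : c.x ∣ g * u)).resolve_left hx
  have huv : c.y * s = g * v := mul_left_cancel₀ c.prime_x.ne_zero (by linear_combination hu)
  obtain ⟨w, rfl⟩ := (c.prime_y.dvd_or_dvd (⟨s, huv.symm⟩ : c.y ∣ g * v)).resolve_left hy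
  exact ⟨w, mul_left_cancel₀ c.prime_y.ne_zero (by linear_combination huv)⟩

theorem X_smul_mk (s : S) : (PowerSeries.X : PowerSeries k) • Ideal.Quotient.mk (Ideal.span {g}) s =
    Ideal.Quotient.mk (Ideal.span {g}) (c.x * c.y * s) := by
  rw [c.x_mul_y, ← Algebra.smul_def]
  rfl

include c in
theorem isHausdorff_span_X_quotient :
    IsHausdorff (Ideal.span {PowerSeries.X} : Ideal (PowerSeries k)) (S ⧸ Ideal.span {g}) := by
  have := c.isNoetherianRing
  have := IsHausdorff.of_le_jacobson (Ideal.jacobson (⊥ : Ideal S)) (S ⧸ Ideal.span {g}) le_rfl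
  refine IsHausdorff.of_map (J := Ideal.jacobson (⊥ : Ideal S)) ?_
  rw [Ideal.map_span, Set.image_singleton, Ideal.span_singleton_le_iff_mem, ← c.x_mul_y]
  exact Ideal.mul_mem_right _ _ c.x_mem_jacobson

theorem nonempty_basis_quotient [IsScalarTower k (PowerSeries k) S] {r : ℕ}
    (h : Cardinal.toENat
      (Module.rank k (S ⧸ (Ideal.span {c.x * c.y} ⊔ Ideal.span {g}))) = (r : ℕ∞)) :
    Nonempty (Module.Basis (Fin r) (PowerSeries k) (S ⧸ Ideal.span {g})) := by
  have hne := h.trans_ne (ENat.natCast_ne_top r)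
  have hrank := Cardinal.toENat_eq_natCast.1 h
  have := Module.rank_lt_aleph0_iff.1 (hrank.trans_lt Cardinal.natCast_lt_aleph0)
  have := c.isHausdorff_span_X_quotient (g := g)
  refine nonempty_basis_of_reduction
    (f := (Ideal.Quotient.factorₐ k (le_sup_right :
      Ideal.span {g} ≤ Ideal.span {c.x * c.y} ⊔ Ideal.span {g})).toLinearMap)
    (Ideal.Quotient.factor_surjective le_sup_right) ?_ ?_
    (Module.finBasisOfFinrankEq k _ (Module.finrank_eq_of_rank_eq hrank))
  · intro q
    obtain ⟨s, rfl⟩ := Ideal.Quotient.mk_surjective q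
    rw [AlgHom.toLinearMap_apply, Ideal.Quotient.factorₐ_apply_mk, Ideal.Quotient.eq_zero_iff_mem,
      Ideal.mem_span_singleton_sup, Ideal.Quotient.mk_surjective.exists]
    simp only [c.X_smul_mk, Ideal.Quotient.eq]
    constructor
    · rintro ⟨a, b, hb, rfl⟩
      refine ⟨a, ?_⟩
      rwa [mul_comm, sub_add_cancel_left, neg_mem_iff]
    · rintro ⟨v, hv⟩
      exact ⟨v, _, neg_mem hv, by ring⟩
  · intro q hq
    obtain ⟨s, rfl⟩ := Ideal.Quotient.mk_surjective q
    rw [c.X_smul_mk, Ideal.Quotient.eq_zero_iff_mem, Ideal.mem_span_singleton] at hq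
    rw [Ideal.Quotient.eq_zero_iff_mem, Ideal.mem_span_singleton]
    exact c.dvd_of_dvd_x_mul_y_mul (c.not_x_dvd_of_toENat_rank_quotient_ne_top hne)
      (c.not_y_dvd_of_toENat_rank_quotient_ne_top hne) hq

end SmoothingChart

/-! ### Automatic degeneracies of the node -/

namespace SmoothingChart

universe u

variable {k S : Type u} [Field k] [CommRing S] [Algebra k S] [Algebra (PowerSeries k) S]
  (c : SmoothingChart k S) {m n : ℕ}

theorem isUnit_det_nodeMatrix_of_le_one (hm : m ≤ 1) : IsUnit (nodeMatrix c.x c.y m m).det := by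
  interval_cases m
  · simp
  · simpa [nodeMatrix, nodeColumn, powerVec] using
      isUnit_add_mul_of_mem_jacobson isUnit_one c.y_mem_jacobson 1

variable [IsScalarTower k (PowerSeries k) S]

include c in
theorem le_toENat_rank_quotient_special
    (e : Module.Basis (Fin m) S (Module.Dual S (PrincipalParts (PowerSeries k) S m)))
    (τ : Fin m → PrincipalParts (PowerSeries k) S m) :
    ((m * (m - 1) : ℕ) : ℕ∞) ≤ Cardinal.toENat (Module.rank k
      (S ⧸ (Ideal.span {algebraMap (PowerSeries k) S PowerSeries.X} ⊔ degeneracyIdeal e τ))) := by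
  rw [degeneracyIdeal, maximalMinorsIdeal_square, ← c.x_mul_y]
  exact c.le_toENat_rank_quotient_of_mem_cornerIdeal (c.det_mem_cornerIdeal e τ)

include c in
theorem exists_toENat_rank_quotient_special_le [CharZero k] (m : ℕ) :
    ∃ (e : Module.Basis (Fin m) S (Module.Dual S (PrincipalParts (PowerSeries k) S m)))
      (τ : Fin m → PrincipalParts (PowerSeries k) S m),
      Cardinal.toENat (Module.rank k
        (S ⧸ (Ideal.span {algebraMap (PowerSeries k) S PowerSeries.X} ⊔ degeneracyIdeal e τ))) ≤
        ((m * (m - 1) : ℕ) : ℕ∞) := by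
  obtain ⟨e, τ, h⟩ := c.exists_degeneracyIdeal_eq_nodeMatrix m m
  refine ⟨e, τ, ?_⟩
  rw [h, maximalMinorsIdeal_square, ← c.x_mul_y, ← two_mul_choose_two]
  rcases le_or_gt m 1 with hm | hm
  · rw [Ideal.span_singleton_eq_top.2 (c.isUnit_det_nodeMatrix_of_le_one hm), sup_top_eq,
      rank_subsingleton', map_zero]
    exact zero_le
  · obtain ⟨α, β, h, hα, hβ, hdet⟩ := exists_det_nodeMatrix_eq k c.y_mem_jacobson hm
    exact c.toENat_rank_quotient_le_of_eq (Nat.choose_pos hm) hα hβ hdet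

include c in
theorem le_toENat_rank_quotient_degeneracyIdeal
    (e : Module.Basis (Fin m) S (Module.Dual S (PrincipalParts (PowerSeries k) S m)))
    (τ : Fin n → PrincipalParts (PowerSeries k) S m) :
    (((min m n + 2).choose 4 : ℕ) : ℕ∞) ≤
      Cardinal.toENat (Module.rank k (S ⧸ degeneracyIdeal e τ)) :=
  c.le_toENat_rank_quotient_of_le_cornerIdeal (c.degeneracyIdeal_le_cornerIdeal e τ)

include c in
theorem exists_toENat_rank_quotient_le_pred [CharZero k] (s : ℕ) :
    ∃ (e : Module.Basis (Fin (s + 1)) S (Module.Dual S (PrincipalParts (PowerSeries k) S (s + 1))))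
      (τ : Fin s → PrincipalParts (PowerSeries k) S (s + 1)),
      Cardinal.toENat (Module.rank k (S ⧸ degeneracyIdeal e τ)) ≤
        (((s + 2).choose 4 : ℕ) : ℕ∞) := by
  obtain ⟨e, τ, h⟩ := c.exists_degeneracyIdeal_eq_nodeMatrix (s + 1) s
  refine ⟨e, τ, c.toENat_rank_quotient_le_of_cornerIdeal_le ?_⟩
  rw [h]
  exact cornerIdeal_le_maximalMinorsIdeal_nodeMatrix_pred k c.x_mem_jacobson c.y_mem_jacobson s

include c in
theorem exists_toENat_rank_quotient_le_succ [CharZero k] (m : ℕ) :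
    ∃ (e : Module.Basis (Fin m) S (Module.Dual S (PrincipalParts (PowerSeries k) S m)))
      (τ : Fin (m + 1) → PrincipalParts (PowerSeries k) S m),
      Cardinal.toENat (Module.rank k (S ⧸ degeneracyIdeal e τ)) ≤
        (((m + 2).choose 4 : ℕ) : ℕ∞) := by
  obtain ⟨e, τ, h⟩ := c.exists_degeneracyIdeal_eq_nodeMatrix m (m + 1)
  refine ⟨e, τ, c.toENat_rank_quotient_le_of_cornerIdeal_le ?_⟩
  rw [h]
  exact cornerIdeal_le_maximalMinorsIdeal_nodeMatrix_succ k c.x_mem_jacobson c.y_mem_jacobson m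

include c in
theorem toENat_rank_genericFibre_eq (K : Type*) [Field K] [Algebra (PowerSeries k) K] {r : ℕ}
    (e : Module.Basis (Fin m) S (Module.Dual S (PrincipalParts (PowerSeries k) S m)))
    (τ : Fin m → PrincipalParts (PowerSeries k) S m)
    (h : Cardinal.toENat (Module.rank k
      (S ⧸ (Ideal.span {algebraMap (PowerSeries k) S PowerSeries.X} ⊔ degeneracyIdeal e τ))) =
        (r : ℕ∞)) :
    Cardinal.toENat (Module.rank K (K ⊗[PowerSeries k] (S ⧸ degeneracyIdeal e τ))) = (r : ℕ∞) := by
  rw [degeneracyIdeal, maximalMinorsIdeal_square] at h ⊢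
  rw [← c.x_mul_y] at h
  obtain ⟨b⟩ := c.nonempty_basis_quotient h
  rw [rank_eq_card_basis (b.baseChange K), Fintype.card_fin, Cardinal.toENat_nat]

end SmoothingChart

section Node

universe u

variable {k : Type u} [Field k] (V : Def1Basis (node k)) {m n : ℕ}

theorem exists_nonempty_smoothingChart :
    ∃ a : Fin V.d → k, Nonempty (SmoothingChart k (TotalRing V a)) := by
  obtain ⟨l, hl⟩ := exists_constantCoeff_ne_zero V
  refine ⟨Pi.single l 1, nonempty_smoothingChart ?_⟩
  rwa [Fintype.sum_eq_single l fun i hi => by rw [Pi.single_eq_of_ne hi, zero_smul],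
    Pi.single_eq_same, one_smul]

variable {V} in
theorem nonempty_smoothingChart_of_basis (hm : 1 < m) {a : Fin V.d → k}
    (e : Module.Basis (Fin m) (TotalRing V a)
      (Module.Dual (TotalRing V a) (PrincipalParts (PowerSeries k) (TotalRing V a) m))) :
    Nonempty (SmoothingChart k (TotalRing V a)) :=
  nonempty_smoothingChart fun h =>
    (isEmpty_basis_dual_of_constantCoeff_eq_zero hm h).false e

theorem AD1_node [CharZero k] (m : ℕ) : AD1 V m = ((m * (m - 1) : ℕ) : ℕ∞) := by
  refine le_antisymm ?_ (le_sInf ?_)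
  · obtain ⟨a, ⟨c⟩⟩ := exists_nonempty_smoothingChart V
    obtain ⟨e, τ, h⟩ := c.exists_toENat_rank_quotient_special_le m
    exact sInf_le_of_le ⟨a, e, τ, rfl⟩ h
  · rintro _ ⟨a, e, τ, rfl⟩
    rcases le_or_gt m 1 with hm | hm
    · simp [Nat.sub_eq_zero_of_le hm]
    · obtain ⟨c⟩ := nonempty_smoothingChart_of_basis hm e
      exact c.le_toENat_rank_quotient_special e τ

theorem le_minColength_node (m n : ℕ) :
    (((min m n + 2).choose 4 : ℕ) : ℕ∞) ≤ minColength V m n := by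
  refine le_sInf ?_
  rintro _ ⟨a, e, τ, rfl⟩
  rcases le_or_gt m 1 with hm | hm
  · simp [Nat.choose_eq_zero_of_lt (show min m n + 2 < 4 by omega)]
  · obtain ⟨c⟩ := nonempty_smoothingChart_of_basis hm e
    exact c.le_toENat_rank_quotient_degeneracyIdeal e τ

theorem AD2_node [CharZero k] (hm : 1 ≤ m) : AD2 V m = (((m + 1).choose 4 : ℕ) : ℕ∞) := by
  obtain ⟨s, rfl⟩ := Nat.exists_eq_add_of_le' hm
  refine le_antisymm ?_ (by simpa [AD2] using le_minColength_node V (s + 1) s)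
  obtain ⟨a, ⟨c⟩⟩ := exists_nonempty_smoothingChart V
  obtain ⟨e, τ, h⟩ := c.exists_toENat_rank_quotient_le_pred s
  exact sInf_le_of_le ⟨a, e, τ, rfl⟩ h

theorem AD11_node [CharZero k] (m : ℕ) : AD11 V m = (((m + 2).choose 4 : ℕ) : ℕ∞) := by
  refine le_antisymm ?_ (by simpa [AD11] using le_minColength_node V m (m + 1))
  obtain ⟨a, ⟨c⟩⟩ := exists_nonempty_smoothingChart V
  obtain ⟨e, τ, h⟩ := c.exists_toENat_rank_quotient_le_succ m
  exact sInf_le_of_le ⟨a, e, τ, rfl⟩ h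

theorem exists_mvPolynomial_ne_zero_and_eval_eq :
    ∃ p : MvPolynomial (Fin V.d) k, p ≠ 0 ∧ ∀ a : Fin V.d → k,
      MvPolynomial.eval a p = MvPowerSeries.constantCoeff (∑ l, a l • V.δ l 0) := by
  obtain ⟨l, hl⟩ := exists_constantCoeff_ne_zero V
  refine ⟨∑ l, MvPolynomial.C (MvPowerSeries.constantCoeff (V.δ l 0)) * MvPolynomial.X l,
    fun h => hl ?_, fun a => by simp [mul_comm]⟩
  simpa [Pi.single_apply] using congrArg (MvPolynomial.eval (Pi.single l 1)) h

theorem limitingWeightOneCount_node [CharZero k] (m : ℕ) :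
    LimitingWeightOneCount V m ((m * (m - 1) : ℕ) : ℕ∞) := by
  obtain ⟨p, hp, hpa⟩ := exists_mvPolynomial_ne_zero_and_eval_eq V
  refine ⟨p, hp, fun a ha => ?_⟩
  obtain ⟨c⟩ := nonempty_smoothingChart (hpa a ▸ ha)
  rw [AD1_node V m]
  refine ⟨?_, fun e τ h => c.toENat_rank_genericFibre_eq _ e τ h⟩
  obtain ⟨e, τ, h⟩ := c.exists_toENat_rank_quotient_special_le m
  exact ⟨e, τ, le_antisymm h (c.le_toENat_rank_quotient_special e τ)⟩

end Node

end AutomaticDegeneracy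

theorem mainTheorem1_general {k : Type*} [Field k] [CharZero k]
    (V : AutomaticDegeneracy.Def1Basis (AutomaticDegeneracy.node k)) (m : ℕ) (hm : 1 ≤ m) :
    (AutomaticDegeneracy.AD1 V m = ((m * (m - 1) : ℕ) : ℕ∞) ∧
      AutomaticDegeneracy.LimitingWeightOneCount V m ((m * (m - 1) : ℕ) : ℕ∞)) ∧
    AutomaticDegeneracy.AD2 V m = ((Nat.choose (m + 1) 4 : ℕ) : ℕ∞) ∧
    AutomaticDegeneracy.AD11 V m = ((Nat.choose (m + 2) 4 : ℕ) : ℕ∞) :=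
  ⟨⟨AutomaticDegeneracy.AD1_node V m, AutomaticDegeneracy.limitingWeightOneCount_node V m⟩,
    AutomaticDegeneracy.AD2_node V hm, AutomaticDegeneracy.AD11_node V m⟩

theorem mainTheorem1 {k : Type*} [Field k] [IsAlgClosed k] [CharZero k]
    (V : AutomaticDegeneracy.Def1Basis (AutomaticDegeneracy.node k)) (m : ℕ) (hm : 1 ≤ m) :
    (AutomaticDegeneracy.AD1 V m = ((m * (m - 1) : ℕ) : ℕ∞) ∧
      AutomaticDegeneracy.LimitingWeightOneCount V m ((m * (m - 1) : ℕ) : ℕ∞)) ∧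
    AutomaticDegeneracy.AD2 V m = ((Nat.choose (m + 1) 4 : ℕ) : ℕ∞) ∧
    AutomaticDegeneracy.AD11 V m = ((Nat.choose (m + 2) 4 : ℕ) : ℕ∞) :=
  mainTheorem1_general V m hm
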